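/- Let $d\ge 1$, let $\Omega\subset\mathbb R^d$ be a non-empty bounded open convex set and $\Lambda\subset\mathbb R^d$ a convex set with $B(0,1/r^*)\subset\Lambda\subset B(0,r^*/2)$ for some $r^*>1$. Let $1<p<\infty$ and $1/p+1/q=1$. For a matrix field $\varphi$, $(\operatorname{div}\varphi)_i=\sum_j\partial_j\varphi_{ij}$; $|\xi|$ and $\xi\cdot\eta$ are the Frobenius norm and inner product on $\mathbb R^{d\times d}$; $f^*(\xi^*)=\sup_\xi\{\xi\cdot\xi^*-f(\xi)\}$. A map $G:\Omega\to\mathbb R^d$ is called non-degenerate if $\mathcal L^d(G^{-1}(N))=0$ whenever $\mathcal L^d(N)=0$. Let $\mathcal S$ be a non-empty closed convex subset of $W^{1,q}_0(\Omega,\mathbb R^{d\times d})$ with finite-dimensional linear span, such that $\operatorname{div}\varphi$ is non-degenerate for every $\varphi\in\mathcal S$. Assume: (A0) the boundary of $\Omega$ is smooth and coincides with the set of extreme points of $\overline\Omega$. (A1) $f:\mathbb R^{d\times d}\to\mathbb R$ is convex and: (i) there are $a,b,c>0$ such that $c\frac{|\xi|^p}{p}+b\ge f(\xi)\ge a|\xi|-b$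 for all $\xi$, and $|\xi^*|^q\le c|\xi|^p+b$ for all $\xi$ and all $\xi^*\in\partial f(\xi)$; (ii) there is $\varphi\in\mathcal S$ with $\int_\Omega f^*(\varphi)\,dx$ finite; (iii) either $f$ is strictly convex, or for every $x^*$ with $f^*(x^*)<\infty$ the set $\partial f^*(x^*)$ is non-empty and its element of minimal norm is $0$. (A2) $H$ is $C^1$ and strictly convex on $(0,\infty)$, with $\lim_{t\to0^+}H(t)=\lim_{t\to\infty}H(t)/t=+\infty$ (and $H(0):=+\infty$). (A3) $F:\Omega\to\mathbb R^d$ is measurable and belongs to $L^1(\Omega)$. Let $\mathscr U_{\mathcal S}$ be the set of measurable $u:\Omega\to\overline\Lambda$ for which there is $\bar c>0$ with $|\int_\Omega u\cdot\operatorname{div}\varphi\,dx|\le\bar c\,\|\varphi\|_{L^q}$ for all $\varphi\in\mathcal S$, and let $\mathscr U^*_{\mathcal S}$ be the set of pairs $(u,\beta)$ with $u\in\mathscr U_{\mathcal S}$, $\beta:\Omega\to[0,\infty)$ measurable, and $\int_\Omega l(u(x))\beta(x)\,dx=\int_\Lambda l(y)\,dy$ for all $l\in C_c(\mathbb R^d)$.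 Put $$V^f_{\mathcal S}(u)=\sup_{\varphi\in\mathcal S}\int_\Omega\bigl(-u\cdot\operatorname{div}\varphi-f^*(\varphi)\bigr)dx,\qquad I(u,\beta)=V^f_{\mathcal S}(u)+\int_\Omega\bigl(H(\beta)-F\cdot u\bigr)dx .$$ Suppose that $F$ has countable range. Then $F$ is degenerate (that is, not non-degenerate), $F$ satisfies condition $(\mathrm{ND})_{\mathcal S}$, that is, $F+\operatorname{div}\varphi$ is non-degenerate for every $\varphi\in\mathcal S$, and the problem $$\inf_{(u,\beta)\in\mathscr U^*_{\mathcal S}} I(u,\beta)$$ admits a minimizer, which is unique up to equality almost everywhere on $\Omega$. -/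

import Mathlib

open MeasureTheory Set Filter Topology
open scoped ENNReal ContDiff

noncomputable section

namespace Polyconvex

/-- The space `ℝ^d` with its Euclidean structure. -/
abbrev Vec (d : ℕ) : Type := EuclideanSpace ℝ (Fin d)

/-- The space `ℝ^{d × d}` of matrices; its norm is the Frobenius norm and its inner product is the
entrywise product. The entry in row `i` and column `j` is indexed by `(i, j)`. -/
abbrev Mat (d : ℕ) : Type := EuclideanSpace ℝ (Fin d × Fin d)

/-! ### Matrix-valued Sobolev maps vanishing on the boundary -/

/-- Lebesgue measure on `Ω`. -/
abbrev vol {d : ℕ} (Ω : Set (Vec d)) : Measure (Vec d) := volume.restrict Ω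

/-- The ambient space `L^q(Ω; ℝ^{d × d}) × L^q(Ω; L(ℝ^d, ℝ^{d × d}))`, in which a Sobolev map `φ` is
represented by the pair `(φ, ∇φ)`. With this convention the norm of the ambient space is a norm
of `W^{1,q}(Ω; ℝ^{d × d})`. -/
abbrev SobolevAmbient (d : ℕ) (Ω : Set (Vec d)) (q : ℝ≥0∞) : Type :=
  Lp (Mat d) q (vol Ω) × Lp (Vec d →L[ℝ] Mat d) q (vol Ω)

/-- The pairs `(φ, ∇φ)` where `φ` is smooth with compact support contained in `Ω`. -/
def testPairs {d : ℕ} (Ω : Set (Vec d)) (q : ℝ≥0∞) : Set (SobolevAmbient d Ω q) :=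
  {g | ∃ φ : Vec d → Mat d, ContDiff ℝ ∞ φ ∧ HasCompactSupport φ ∧ tsupport φ ⊆ Ω ∧
    g.1 =ᵐ[vol Ω] φ ∧ g.2 =ᵐ[vol Ω] fderiv ℝ φ}

/-- `W_0^{1,q}(Ω; ℝ^{d × d})`, the closure of the smooth compactly supported maps for the
`W^{1,q}` norm. -/
def sobolevZero {d : ℕ} (Ω : Set (Vec d)) (q : ℝ≥0∞) [Fact (1 ≤ q)] :
    Set (SobolevAmbient d Ω q) :=
  closure (testPairs Ω q)

/-- The row-wise divergence: `(div φ)_i = ∑_j ∂_j φ_{ij}`. -/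
def div {d : ℕ} {Ω : Set (Vec d)} {q : ℝ≥0∞} (φ : SobolevAmbient d Ω q) (x : Vec d) : Vec d :=
  WithLp.toLp 2 fun i => ∑ j, (φ.2 x (EuclideanSpace.single j 1)) (i, j)

/-! ### Convex analysis -/

/-- The Legendre transform of a real-valued function, with values in `(-∞, ∞]`. -/
def legendre {X : Type*} [NormedAddCommGroup X] [InnerProductSpace ℝ X] (f : X → ℝ) (y : X) :
    EReal :=
  ⨆ x : X, ((inner ℝ x y - f x : ℝ) : EReal)

/-- The effective domain `Dom h`. -/
def effDom {X : Type*} (h : X → EReal) : Set X := {x | h x ≠ ⊤}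

/-- The subdifferential `∂h(x)`, for `x` in the effective domain of `h`. -/
def subdiff {X : Type*} [NormedAddCommGroup X] [InnerProductSpace ℝ X] (h : X → EReal) (x : X) :
    Set X :=
  {y | x ∈ effDom h ∧ ∀ z, h x + ((inner ℝ y (z - x) : ℝ) : EReal) ≤ h z}

/-- `y = grad[h](x)`: the element of minimal norm of the subdifferential `∂h(x)`. -/
def IsGrad {X : Type*} [NormedAddCommGroup X] [InnerProductSpace ℝ X] (h : X → EReal) (x y : X) :
    Prop :=
  y ∈ subdiff h x ∧ ∀ z ∈ subdiff h x, ‖y‖ ≤ ‖z‖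

/-- The integral of an extended-real-valued function, as the integral of its positive part minus
that of its negative part. It is only used for functions that are bounded below on a set of
finite measure. -/
def extIntegral {X : Type*} [MeasurableSpace X] (μ : Measure X) (g : X → EReal) : EReal :=
  ((∫⁻ x, (g x).toENNReal ∂μ : ℝ≥0∞) : EReal) - ((∫⁻ x, (-g x).toENNReal ∂μ : ℝ≥0∞) : EReal)

/-! ### Standing assumptions -/

/-- A map defined on `Ω` is non-degenerate if preimages of Lebesgue null sets are null sets. -/
def NonDegenerate {d : ℕ} (Ω : Set (Vec d)) (G : Vec d → Vec d) : Prop :=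
  ∀ N : Set (Vec d), volume N = 0 → volume (Ω ∩ G ⁻¹' N) = 0

/-- The boundary of `Ω` is smooth: near each boundary point, `Ω` is the sublevel set of a smooth
function with non-vanishing differential. -/
def HasSmoothBoundary {d : ℕ} (Ω : Set (Vec d)) : Prop :=
  ∀ x ∈ frontier Ω, ∃ U : Set (Vec d), IsOpen U ∧ x ∈ U ∧ ∃ ρ : Vec d → ℝ,
    ContDiffOn ℝ ∞ ρ U ∧ fderiv ℝ ρ x ≠ 0 ∧ Ω ∩ U = {y ∈ U | ρ y < 0}

/-- Assumption (A0): the boundary of `Ω` is smooth and coincides with the set of extreme points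
(of the closure of `Ω`). -/
structure AssumptionA0 {d : ℕ} (Ω : Set (Vec d)) : Prop where
  smooth : HasSmoothBoundary Ω
  extreme : (closure Ω).extremePoints ℝ = frontier Ω

/-- The set of the `φ ∈ S` for which `∫_Ω f^*(φ)` is finite. -/
def finiteSet {d : ℕ} {Ω : Set (Vec d)} {q : ℝ≥0∞} (f : Mat d → ℝ)
    (S : Set (SobolevAmbient d Ω q)) : Set (SobolevAmbient d Ω q) :=
  {φ ∈ S | extIntegral (vol Ω) (fun x => legendre f (φ.1 x)) ≠ ⊤ ∧
    extIntegral (vol Ω) (fun x => legendre f (φ.1 x)) ≠ ⊥}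

/-- Assumption (A1) on `f`; its second part also involves the set `S`. -/
structure AssumptionA1 {d : ℕ} {Ω : Set (Vec d)} (p q : ℝ) (f : Mat d → ℝ)
    (S : Set (SobolevAmbient d Ω (ENNReal.ofReal q))) : Prop where
  convex : ConvexOn ℝ univ f
  growth : ∃ a b c : ℝ, 0 < a ∧ 0 < b ∧ 0 < c ∧
    (∀ ξ, f ξ ≤ c * (‖ξ‖ ^ p / p) + b ∧ a * ‖ξ‖ - b ≤ f ξ) ∧
    ∀ ξ, ∀ ξ' ∈ subdiff (fun η => (f η : EReal)) ξ, ‖ξ'‖ ^ q ≤ c * ‖ξ‖ ^ p + b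
  finite_nonempty : (finiteSet f S).Nonempty
  strict_or_grad_zero : StrictConvexOn ℝ univ f ∨
    ∀ y ∈ effDom (legendre f), (subdiff (legendre f) y).Nonempty ∧ IsGrad (legendre f) y 0

/-- Assumption (A2) on `H`; only the values of `H` on `(0, ∞)` matter. -/
structure AssumptionA2 (H : ℝ → ℝ) : Prop where
  contDiff : ContDiffOn ℝ 1 H (Ioi 0)
  strictConvex : StrictConvexOn ℝ (Ioi 0) H
  tendsto_zero : Tendsto H (𝓝[>] 0) atTop
  tendsto_infty : Tendsto (fun t => H t / t) atTop atTop

/-- The condition `(ND)_S`: the map `F + div φ` is non-degenerate for all `φ ∈ S`. -/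
def ConditionND {d : ℕ} {Ω : Set (Vec d)} {q : ℝ≥0∞} (F : Vec d → Vec d)
    (S : Set (SobolevAmbient d Ω q)) : Prop :=
  ∀ φ ∈ S, NonDegenerate Ω (fun x => div φ x + F x)

/-! ### The minimization problem -/

/-- The set `𝒰_S` of (Lebesgue) measurable maps `u : Ω → closure Λ` for which
`φ ↦ ∫_Ω u · div φ` is bounded on `S` by a multiple of the `L^q` norm. -/
def admissibleMaps {d : ℕ} {Ω : Set (Vec d)} {q : ℝ≥0∞} (Λ : Set (Vec d))
    (S : Set (SobolevAmbient d Ω q)) : Set (Vec d → Vec d) :=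
  {u | AEMeasurable u (vol Ω) ∧ (∀ x ∈ Ω, u x ∈ closure Λ) ∧
    ∃ c : ℝ, 0 < c ∧ ∀ φ ∈ S, |∫ x in Ω, inner ℝ (u x) (div φ x)| ≤ c * ‖φ.1‖}

/-- The set `𝒰*_S` of pairs `(u, β)` with `u ∈ 𝒰_S`, `β : Ω → [0, ∞)` measurable, and
`∫_Ω l(u(x)) β(x) dx = ∫_Λ l(y) dy` for all `l ∈ C_c(ℝ^d)`. -/
def admissiblePairs {d : ℕ} {Ω : Set (Vec d)} {q : ℝ≥0∞} (Λ : Set (Vec d))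
    (S : Set (SobolevAmbient d Ω q)) : Set ((Vec d → Vec d) × (Vec d → ℝ)) :=
  {w | w.1 ∈ admissibleMaps Λ S ∧ AEMeasurable w.2 (vol Ω) ∧ (∀ x ∈ Ω, 0 ≤ w.2 x) ∧
    ∀ l : Vec d → ℝ, Continuous l → HasCompactSupport l →
      IntegrableOn (fun x => l (w.1 x) * w.2 x) Ω ∧
      ∫ x in Ω, l (w.1 x) * w.2 x = ∫ y in Λ, l y}

/-- The functional `V_S^f(u) = sup_{φ ∈ S} ∫_Ω (- u · div φ - f^*(φ))`. -/
def extGradEnergy {d : ℕ} {Ω : Set (Vec d)} {q : ℝ≥0∞} (f : Mat d → ℝ)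
    (S : Set (SobolevAmbient d Ω q)) (u : Vec d → Vec d) : EReal :=
  ⨆ φ ∈ S, (((-∫ x in Ω, inner ℝ (u x) (div φ x) : ℝ) : EReal) -
    extIntegral (vol Ω) (fun x => legendre f (φ.1 x)))

/-- `H` extended by `H(0) = lim_{t → 0+} H(t) = +∞`. -/
def extendH (H : ℝ → ℝ) (t : ℝ) : EReal := open Classical in if 0 < t then (H t : EReal) else ⊤

/-- The functional `I(u, β) = V_S^f(u) + ∫_Ω (H(β) - F · u) dx`. -/
def energy {d : ℕ} {Ω : Set (Vec d)} {q : ℝ≥0∞} (f : Mat d → ℝ) (H : ℝ → ℝ) (F : Vec d → Vec d)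
    (S : Set (SobolevAmbient d Ω q)) (w : (Vec d → Vec d) × (Vec d → ℝ)) : EReal :=
  extGradEnergy f S w.1 + extIntegral (vol Ω) (fun x => extendH H (w.2 x)) -
    ((∫ x in Ω, inner ℝ (F x) (w.1 x) : ℝ) : EReal)

/-- `w` is a minimizer of the energy over `𝒰*_S`. -/
def IsMinimizer {d : ℕ} {Ω : Set (Vec d)} {q : ℝ≥0∞} (Λ : Set (Vec d)) (f : Mat d → ℝ)
    (H : ℝ → ℝ) (F : Vec d → Vec d) (S : Set (SobolevAmbient d Ω q))
    (w : (Vec d → Vec d) × (Vec d → ℝ)) : Prop :=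
  w ∈ admissiblePairs Λ S ∧ IsMinOn (energy f H F S) (admissiblePairs Λ S) w

end Polyconvex

end

/-! The proof is by duality. Write `U` for `interior Λ` and k for the conjugate `conj H U l`, so
that k(v) is the supremum of u · v - H(t) - t l(u) over u in `U` and t > 0. The dual functional is
J(l, φ) = ∫_U l + ∫_Ω k(F + div φ) + ∫_Ω f^*(φ), called `dualValue`. If (u, β) is admissible with
finite `H`-energy, the push-forward constraint gives ∫_Ω β l(u) = ∫_U l. The definitions of V and k
then yield I(u, β) ≥ -J(l, φ).

J attains its minimum (`exists_dual_minimizer`). The span of `S` is finite-dimensional, the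
conjugates are uniformly Lipschitz because `U` is bounded, and J controls both k(0) and the norm of
φ. A limit k₀ of the conjugates produces a new convex potential, `potential H k₀`, which does not
increase J.

Adding a map of countable range preserves non-degeneracy, since it only translates null sets
countably many times. By Rademacher's theorem k is therefore differentiable at F(x) + div φ(x) for
almost every x. At such a point any maximizing sequence (u, t) converges to one limit
(`tendsto_of_tendsto_conj`): u tends to the gradient of k, and t is determined by strict convexity
of `H`. These limits define `optPair`. Varying l in J shows that it satisfies the push-forward
constraint (`first_order_potential`), and varying φ shows that φ attains V (`first_order_sobolev`).
Hence its energy is at most -J (`energy_optPair_le`). Conversely, a pair with energy at most -J must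
attain the supremum defining k almost everywhere, so it equals `optPair`
(`eq_optPair_of_energy_le`). This gives minimality and uniqueness together. -/

noncomputable section

namespace Polyconvex

/-! ### Extended-real-valued integrals -/

section ExtIntegral

variable {X : Type*} [MeasurableSpace X] {μ : Measure X}

lemma extIntegral_congr_ae {g h : X → EReal} (hgh : g =ᵐ[μ] h) :
    extIntegral μ g = extIntegral μ h := by
  unfold extIntegral
  rw [lintegral_congr_ae (g := fun x => (h x).toENNReal) (hgh.mono fun x hx => by simp only [hx]),
    lintegral_congr_ae (f := fun x => (-g x).toENNReal) (g := fun x => (-h x).toENNReal)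
      (hgh.mono fun x hx => by simp only [hx])]

lemma extIntegral_coe {h : X → ℝ} (hh : Integrable h μ) :
    extIntegral μ (fun x => (h x : EReal)) = ((∫ x, h x ∂μ : ℝ) : EReal) := by
  unfold extIntegral
  have h1 : ∫⁻ x, ENNReal.ofReal (h x) ∂μ ≠ ⊤ := hh.lintegral_lt_top.ne
  have h2 : ∫⁻ x, ENNReal.ofReal (-h x) ∂μ ≠ ⊤ := hh.neg.lintegral_lt_top.ne
  rw [integral_eq_lintegral_pos_part_sub_lintegral_neg_part hh, EReal.coe_sub]
  simp only [← EReal.coe_neg, EReal.real_coe_toENNReal]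
  rw [← EReal.coe_ennreal_toReal h1, ← EReal.coe_ennreal_toReal h2]

lemma toENNReal_neg_le {y : EReal} {M : ℝ} (h : ((-M : ℝ) : EReal) ≤ y) :
    (-y).toENNReal ≤ ENNReal.ofReal M := by
  have : -y ≤ (M : EReal) := by
    rw [EReal.neg_le]
    simpa using h
  simpa using EReal.toENNReal_le_toENNReal this

lemma lintegral_neg_ne_top [IsFiniteMeasure μ] {g : X → EReal} {M : ℝ}
    (hM : ∀ᵐ x ∂μ, ((-M : ℝ) : EReal) ≤ g x) : ∫⁻ x, (-g x).toENNReal ∂μ ≠ ⊤ := by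
  refine ne_top_of_le_ne_top ?_ (lintegral_mono_ae (g := fun _ => ENNReal.ofReal M)
    (hM.mono fun x hx => toENNReal_neg_le hx))
  simp [ENNReal.mul_eq_top]

lemma extIntegral_ne_bot [IsFiniteMeasure μ] {g : X → EReal} {M : ℝ}
    (hM : ∀ᵐ x ∂μ, ((-M : ℝ) : EReal) ≤ g x) : extIntegral μ g ≠ ⊥ := by
  unfold extIntegral
  lift ∫⁻ x, (-g x).toENNReal ∂μ to NNReal using lintegral_neg_ne_top hM with b hb
  rw [sub_eq_add_neg]
  refine EReal.add_ne_bot_iff.2 ⟨EReal.coe_ennreal_ne_bot _, ?_⟩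
  rw [Ne, EReal.neg_eq_bot_iff]
  simp

/-- On a finite measure space a lower bound makes the negative part integrable. An integral other
than `⊤` thus forces the positive part to be integrable too, and everything reduces to a Bochner
integral. -/
lemma ae_eq_coe_of_extIntegral_ne_top [IsFiniteMeasure μ] {g : X → EReal}
    (hg : AEMeasurable g μ) {M : ℝ} (hM : ∀ᵐ x ∂μ, ((-M : ℝ) : EReal) ≤ g x)
    (h : extIntegral μ g ≠ ⊤) :
    g =ᵐ[μ] (fun x => ((g x).toReal : EReal)) ∧ Integrable (fun x => (g x).toReal) μ ∧
      extIntegral μ g = ((∫ x, (g x).toReal ∂μ : ℝ) : EReal) := by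
  have hpos : ∫⁻ x, (g x).toENNReal ∂μ ≠ ⊤ := by
    intro htop
    apply h
    unfold extIntegral
    rw [htop]
    lift ∫⁻ x, (-g x).toENNReal ∂μ to NNReal using lintegral_neg_ne_top hM with b hb
    rfl
  have hneg := lintegral_neg_ne_top hM
  have hfin : ∀ᵐ x ∂μ, (g x).toENNReal < ⊤ :=
    ae_lt_top' (measurable_ereal_toENNReal.comp_aemeasurable hg) hpos
  have h1 : g =ᵐ[μ] (fun x => ((g x).toReal : EReal)) := by
    filter_upwards [hfin, hM] with x hx hx'
    rw [EReal.coe_toReal]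
    · exact EReal.toENNReal_ne_top_iff.1 hx.ne
    · rintro h0
      rw [h0] at hx'
      simp at hx'
  have h2 : Integrable (fun x => (g x).toReal) μ := by
    refine ⟨hg.ereal_toReal.aestronglyMeasurable, ?_⟩
    rw [hasFiniteIntegral_iff_enorm]
    have : ∫⁻ x, ‖(g x).toReal‖ₑ ∂μ ≤ ∫⁻ x, ((g x).toENNReal + (-g x).toENNReal) ∂μ := by
      refine lintegral_mono_ae ?_
      filter_upwards [h1] with x hx
      rw [hx, ← EReal.coe_neg, EReal.real_coe_toENNReal, EReal.real_coe_toENNReal, EReal.toReal_coe]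
      set y := (g x).toReal
      rcases le_total 0 y with hy | hy
      · rw [Real.enorm_of_nonneg hy]; exact le_self_add
      · rw [← enorm_neg, Real.enorm_of_nonneg (by linarith)]; exact le_add_self
    refine lt_of_le_of_lt this ?_
    rw [lintegral_add_left' (f := fun x => (g x).toENNReal)
      (measurable_ereal_toENNReal.comp_aemeasurable hg)]
    exact ENNReal.add_lt_top.2 ⟨hpos.lt_top, hneg.lt_top⟩
  refine ⟨h1, h2, ?_⟩
  rw [extIntegral_congr_ae h1, extIntegral_coe h2]

/-- Fatou's lemma for a limit function with values in `(-∞, ∞]`. -/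
lemma fatou_ereal [IsFiniteMeasure μ] {g : X → EReal} (hg : AEMeasurable g μ) {M : ℝ}
    (hM : ∀ᵐ x ∂μ, ((-M : ℝ) : EReal) ≤ g x) {G : ℕ → X → ℝ} (hG : ∀ n, Integrable (G n) μ)
    (hGM : ∀ n, ∀ᵐ x ∂μ, -M ≤ G n x) {a : ℝ} (ha : Tendsto (fun n => ∫ x, G n x ∂μ) atTop (𝓝 a))
    (hle : ∀ᵐ x ∂μ, ∀ c : ℝ, (c : EReal) < g x → ∀ᶠ n in atTop, c ≤ G n x) :
    g =ᵐ[μ] (fun x => ((g x).toReal : EReal)) ∧ Integrable (fun x => (g x).toReal) μ ∧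
      ∫ x, (g x).toReal ∂μ ≤ a := by
  set m := μ.real univ
  -- Adding `M` makes all functions non-negative, so the classical Fatou lemma applies. The
  -- hypothesis `hle` expresses g ≤ liminf G n through real thresholds, the form in which it comes
  -- for suprema of continuous functions.
  have hbd : ∫⁻ x, (g x + (M : EReal)).toENNReal ∂μ ≤ ENNReal.ofReal (a + M * m) := by
    have h1 : ∀ᵐ x ∂μ, (g x + (M : EReal)).toENNReal ≤
        liminf (fun n => ENNReal.ofReal (G n x + M)) atTop := by
      filter_upwards [hle] with x hx
      refine le_of_forall_lt fun b hb => ?_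
      obtain ⟨b', hbb', hb'⟩ := exists_between hb
      refine lt_of_lt_of_le hbb' ?_
      refine le_liminf_of_le (by isBoundedDefault) ?_
      lift b' to NNReal using hb'.ne_top
      have hc : ((b' - M : ℝ) : EReal) < g x := by
        by_contra hcon
        push Not at hcon
        have h2 : g x + (M : EReal) ≤ ((b' : ℝ) : EReal) := by
          calc g x + (M : EReal) ≤ ((b' - M : ℝ) : EReal) + (M : EReal) := by gcongr
            _ = _ := by rw [← EReal.coe_add]; simp
        have h3 := EReal.toENNReal_le_toENNReal h2
        rw [EReal.real_coe_toENNReal, ENNReal.ofReal_coe_nnreal] at h3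
        exact absurd hb' (not_lt.2 h3)
      filter_upwards [hx _ hc] with n hn
      rw [← ENNReal.ofReal_coe_nnreal]
      exact ENNReal.ofReal_le_ofReal (by linarith)
    have h2 : Tendsto (fun n => ∫⁻ x, ENNReal.ofReal (G n x + M) ∂μ) atTop
        (𝓝 (ENNReal.ofReal (a + M * m))) := by
      have : ∀ n, ∫⁻ x, ENNReal.ofReal (G n x + M) ∂μ =
          ENNReal.ofReal (∫ x, G n x ∂μ + M * m) := by
        intro n
        rw [← ofReal_integral_eq_lintegral_ofReal (f := fun x => G n x + M)
          ((hG n).add (integrable_const M))]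
        · congr 1
          rw [integral_add (hG n) (integrable_const M)]
          simp [m, mul_comm]
        · filter_upwards [hGM n] with x hx
          simp only [Pi.zero_apply]
          linarith
      simp only [this]
      exact (ENNReal.continuous_ofReal.tendsto _).comp (ha.add_const _)
    calc _ ≤ ∫⁻ x, liminf (fun n => ENNReal.ofReal (G n x + M)) atTop ∂μ := lintegral_mono_ae h1
      _ ≤ liminf (fun n => ∫⁻ x, ENNReal.ofReal (G n x + M) ∂μ) atTop :=
        lintegral_liminf_le' fun n => ((hG n).aemeasurable.add_const M).ennreal_ofReal
      _ = _ := h2.liminf_eq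
  have hmeas : AEMeasurable (fun x => g x + (M : EReal)) μ := hg.add_const _
  have hfin := ae_lt_top' (measurable_ereal_toENNReal.comp_aemeasurable hmeas)
    (ne_top_of_le_ne_top ENNReal.ofReal_ne_top hbd)
  have h1 : g =ᵐ[μ] (fun x => ((g x).toReal : EReal)) := by
    filter_upwards [hfin, hM] with x hx hx'
    rw [EReal.coe_toReal]
    · intro h0
      simp [h0] at hx
    · rintro h0
      rw [h0] at hx'
      simp at hx'
  have hge : ∀ᵐ x ∂μ, 0 ≤ (g x).toReal + M := by
    filter_upwards [h1, hM] with x hx hx'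
    rw [hx] at hx'
    have := EReal.coe_le_coe_iff.1 hx'
    linarith
  have hl : ∫⁻ x, (g x + (M : EReal)).toENNReal ∂μ =
      ∫⁻ x, ENNReal.ofReal ((g x).toReal + M) ∂μ := by
    refine lintegral_congr_ae ?_
    filter_upwards [h1] with x hx
    rw [hx, ← EReal.coe_add, EReal.real_coe_toENNReal, EReal.toReal_coe]
  rw [hl] at hbd
  have hi' : Integrable (fun x => (g x).toReal + M) μ := by
    refine ⟨(hg.ereal_toReal.add_const M).aestronglyMeasurable, ?_⟩
    rw [hasFiniteIntegral_iff_ofReal hge]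
    exact lt_of_le_of_lt hbd ENNReal.ofReal_lt_top
  have hi : Integrable (fun x => (g x).toReal) μ := by
    refine (hi'.sub (integrable_const M)).congr (ae_of_all _ fun x => ?_)
    simp
  refine ⟨h1, hi, ?_⟩
  -- Non-negativity is needed to remove `ENNReal.ofReal` from the bound `hbd`.
  have h0 : 0 ≤ a + M * m := by
    refine ge_of_tendsto' (ha.add_const (M * m)) fun n => ?_
    have : ∫ x, G n x ∂μ + M * m = ∫ x, (G n x + M) ∂μ := by
      rw [integral_add (hG n) (integrable_const M)]
      simp [m, mul_comm]
    rw [this]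
    exact integral_nonneg_of_ae ((hGM n).mono fun x hx => by simp only [Pi.zero_apply]; linarith)
  rw [← ofReal_integral_eq_lintegral_ofReal hi' hge, ENNReal.ofReal_le_ofReal_iff h0,
    integral_add hi (integrable_const M)] at hbd
  simp only [integral_const, smul_eq_mul] at hbd
  have : μ.real univ * M = M * m := mul_comm _ _
  linarith

end ExtIntegral

/-! ### Legendre transforms -/

section Legendre

variable {X : Type*} [NormedAddCommGroup X] [InnerProductSpace ℝ X]

lemma measurable_legendre [MeasurableSpace X] [BorelSpace X] (f : X → ℝ) :
    Measurable (legendre f) := by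
  unfold legendre
  refine LowerSemicontinuous.measurable (lowerSemicontinuous_iSup fun x => ?_)
  refine Continuous.lowerSemicontinuous ?_
  exact continuous_coe_real_ereal.comp (by fun_prop)

lemma le_legendre (f : X → ℝ) (x y : X) :
    ((inner ℝ x y - f x : ℝ) : EReal) ≤ legendre f y :=
  le_iSup (fun x : X => ((inner ℝ x y - f x : ℝ) : EReal)) x

lemma neg_le_legendre (f : X → ℝ) (y : X) : ((-f 0 : ℝ) : EReal) ≤ legendre f y := by
  simpa using le_legendre f 0 y

lemma legendre_convex_comb (f : X → ℝ) {y z : X} {a b : ℝ} (ha : 0 ≤ a) (hb : 0 ≤ b)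
    (hab : a + b = 1) {s t : ℝ} (hy : legendre f y ≤ s) (hz : legendre f z ≤ t) :
    legendre f (a • y + b • z) ≤ ((a * s + b * t : ℝ) : EReal) := by
  refine iSup_le fun x => EReal.coe_le_coe_iff.2 ?_
  have h1 := EReal.coe_le_coe_iff.1 ((le_legendre f x y).trans hy)
  have h2 := EReal.coe_le_coe_iff.1 ((le_legendre f x z).trans hz)
  rw [inner_add_right, inner_smul_right, inner_smul_right]
  have : f x = a * f x + b * f x := by rw [← add_mul, hab, one_mul]
  nlinarith [mul_le_mul_of_nonneg_left h1 ha, mul_le_mul_of_nonneg_left h2 hb]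

/-- The Legendre transform of a function bounded on the ball of radius `A` grows at least
linearly with slope `A`. -/
lemma linear_le_legendre (f : X → ℝ) {A C : ℝ} (hA : 0 ≤ A) (hC : ∀ x, ‖x‖ ≤ A → f x ≤ C) (y : X) :
    ((A * ‖y‖ - C : ℝ) : EReal) ≤ legendre f y := by
  by_cases hy : y = 0
  · refine le_trans (EReal.coe_le_coe_iff.2 ?_) (neg_le_legendre f y)
    have := hC 0 (by simpa using hA)
    simp only [hy, norm_zero]
    linarith
  · have hy' : 0 < ‖y‖ := norm_pos_iff.2 hy
    refine le_trans (EReal.coe_le_coe_iff.2 ?_) (le_legendre f ((A / ‖y‖) • y) y)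
    have h1 := hC ((A / ‖y‖) • y) (by
      rw [norm_smul, Real.norm_of_nonneg (by positivity), div_mul_cancel₀ _ hy'.ne'])
    rw [inner_smul_left, real_inner_self_eq_norm_sq]
    have : (starRingEnd ℝ) (A / ‖y‖) * ‖y‖ ^ 2 = A * ‖y‖ := by
      simp only [conj_trivial]; field_simp
    linarith

end Legendre

/-! ### Sobolev maps vanishing on the boundary -/

section Lp

variable {X : Type*} [MeasurableSpace X] {μ : Measure X} [IsFiniteMeasure μ]
  {E : Type*} [NormedAddCommGroup E] {q : ℝ≥0∞} [hq : Fact (1 ≤ q)]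

lemma integrable_Lp (g : Lp E q μ) : Integrable g μ :=
  memLp_one_iff_integrable.1 ((Lp.memLp g).mono_exponent hq.out)

lemma exists_integral_norm_le (E : Type*) [NormedAddCommGroup E] (μ : Measure X)
    [IsFiniteMeasure μ] (q : ℝ≥0∞) [hq : Fact (1 ≤ q)] :
    ∃ C : ℝ, 0 ≤ C ∧ ∀ g : Lp E q μ, ∫ x, ‖g x‖ ∂μ ≤ C * ‖g‖ := by
  refine ⟨(μ univ ^ (1 - 1 / q.toReal)).toReal, ENNReal.toReal_nonneg, fun g => ?_⟩
  have h := eLpNorm_le_eLpNorm_mul_rpow_measure_univ hq.out (Lp.aestronglyMeasurable g)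
  rw [integral_norm_eq_lintegral_enorm (Lp.aestronglyMeasurable g),
    ← eLpNorm_one_eq_lintegral_enorm, Lp.norm_def, mul_comm, ← ENNReal.toReal_mul]
  have hpos : 0 ≤ 1 - 1 / q.toReal := by
    rcases eq_or_ne q ⊤ with rfl | hqt
    · simp
    · have : 1 ≤ q.toReal := by
        rw [← ENNReal.toReal_one]
        exact (ENNReal.toReal_le_toReal ENNReal.one_ne_top hqt).2 hq.out
      rw [sub_nonneg, div_le_one (by linarith)]
      exact this
  simp only [ENNReal.toReal_one, ne_eq, one_ne_zero, not_false_eq_true, div_self] at h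
  refine ENNReal.toReal_mono (ENNReal.mul_ne_top (Lp.eLpNorm_ne_top g) ?_) h
  exact ENNReal.rpow_ne_top_of_nonneg hpos (measure_ne_top _ _)

variable [NormedSpace ℝ E]

/-- The linear embedding of `L^q` into `L^1` on a finite measure space. -/
def toL1 (E : Type*) [NormedAddCommGroup E] [NormedSpace ℝ E] (μ : Measure X)
    [IsFiniteMeasure μ] (q : ℝ≥0∞) [hq : Fact (1 ≤ q)] : Lp E q μ →ₗ[ℝ] Lp E 1 μ where
  toFun g := ((Lp.memLp g).mono_exponent hq.out).toLp g
  map_add' g h := by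
    rw [← MemLp.toLp_add, MemLp.toLp_eq_toLp_iff]
    exact Lp.coeFn_add g h
  map_smul' c g := by
    rw [← MemLp.toLp_const_smul, MemLp.toLp_eq_toLp_iff]
    exact Lp.coeFn_smul c g

lemma norm_toL1 (g : Lp E q μ) : ‖toL1 E μ q g‖ = ∫ x, ‖g x‖ ∂μ := by
  rw [L1.norm_eq_integral_norm]
  exact integral_congr_ae ((MemLp.coeFn_toLp ((Lp.memLp g).mono_exponent hq.out)).mono
    fun x hx => by simp only [toL1, LinearMap.coe_mk, AddHom.coe_mk, hx])

lemma toL1_eq_zero {g : Lp E q μ} (h : toL1 E μ q g = 0) : g = 0 := by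
  have h0 : ‖toL1 E μ q g‖ = 0 := by rw [h, norm_zero]
  rw [norm_toL1, integral_eq_zero_iff_of_nonneg (fun _ => norm_nonneg _)
    (integrable_Lp g).norm] at h0
  rw [Lp.eq_zero_iff_ae_eq_zero]
  exact h0.mono fun x hx => by simpa using hx

/-- Integration against a bounded weight is a continuous linear map on `L^q`. -/
lemma exists_integralSMul [CompleteSpace E] {ψ : X → ℝ} (hψ : AEStronglyMeasurable ψ μ) {C : ℝ}
    (hC0 : 0 ≤ C) (hC : ∀ x, ‖ψ x‖ ≤ C) :
    ∃ L : Lp E q μ →L[ℝ] E, ∀ g, L g = ∫ x, ψ x • g x ∂μ := by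
  obtain ⟨D, hD, hD'⟩ := exists_integral_norm_le E μ q
  have hint : ∀ g : Lp E q μ, Integrable (fun x => ψ x • g x) μ := fun g =>
    (integrable_Lp g).bdd_smul C hψ (ae_of_all _ hC)
  refine ⟨LinearMap.mkContinuous
    { toFun := fun g => ∫ x, ψ x • g x ∂μ
      map_add' := fun g h => by
        rw [← integral_add (hint g) (hint h)]
        refine integral_congr_ae ((Lp.coeFn_add g h).mono fun x hx => ?_)
        simp only [hx, Pi.add_apply, smul_add]
      map_smul' := fun c g => by
        simp only [RingHom.id_apply]
        rw [← integral_smul]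
        refine integral_congr_ae ((Lp.coeFn_smul c g).mono fun x hx => ?_)
        simp only [hx, Pi.smul_apply, smul_comm c] } (C * D) fun g => ?_, fun g => rfl⟩
  simp only [LinearMap.coe_mk, AddHom.coe_mk]
  calc ‖∫ x, ψ x • g x ∂μ‖ ≤ ∫ x, C * ‖g x‖ ∂μ := by
        refine norm_integral_le_of_norm_le ((integrable_Lp g).norm.const_mul C)
          (ae_of_all _ fun x => ?_)
        rw [norm_smul]
        gcongr
        exact hC x
    _ = C * ∫ x, ‖g x‖ ∂μ := integral_const_mul _ _
    _ ≤ C * (D * ‖g‖) := by gcongr; exact hD' g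
    _ = _ := by ring

end Lp

section Sobolev

variable {d : ℕ} {Ω : Set (Vec d)} {q : ℝ≥0∞}

/-! ### Weak gradients and equivalence of norms on the span of `S` -/

section Gradient

variable [hq : Fact (1 ≤ q)]

/-- Since `η` and its derivative vanish outside `Ω`, both integrals extend to the whole space, where
integration by parts has no boundary term. -/
lemma setIntegral_smul_fderiv_eq {V W : Type*} [NormedAddCommGroup V] [NormedSpace ℝ V]
    [FiniteDimensional ℝ V] [MeasurableSpace V] [BorelSpace V] [NormedAddCommGroup W]
    [NormedSpace ℝ W] [CompleteSpace W] {μ : Measure V} [μ.IsAddHaarMeasure] {Ω : Set V}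
    {η : V → W} (hη : ContDiff ℝ 1 η) (hηΩ : tsupport η ⊆ Ω) {ψ : V → ℝ}
    (hψ : ContDiff ℝ 1 ψ) (hψc : HasCompactSupport ψ) (v : V) :
    (∫ x in Ω, ψ x • fderiv ℝ η x ∂μ) v = -∫ x in Ω, fderiv ℝ ψ x v • η x ∂μ := by
  have hfd : Continuous (fun x => fderiv ℝ ψ x v) :=
    (hψ.continuous_fderiv one_ne_zero).clm_apply continuous_const
  have hfdc : HasCompactSupport (fun x => fderiv ℝ ψ x v) :=
    (hψc.fderiv ℝ).comp_left (g := fun A : V →L[ℝ] ℝ => A v) rfl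
  have hηd : Continuous (fderiv ℝ η) := hη.continuous_fderiv one_ne_zero
  have hout : ∀ x, x ∉ Ω → η x = 0 := fun x hx => image_eq_zero_of_notMem_tsupport
    fun h => hx (hηΩ h)
  have hout' : ∀ x, x ∉ Ω → fderiv ℝ η x = 0 := fun x hx => image_eq_zero_of_notMem_tsupport
    fun h => hx (hηΩ (tsupport_fderiv_subset ℝ h))
  rw [setIntegral_eq_integral_of_forall_compl_eq_zero fun x hx => by rw [hout' x hx, smul_zero],
    setIntegral_eq_integral_of_forall_compl_eq_zero fun x hx => by rw [hout x hx, smul_zero]]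
  have i1 : Integrable (fun x => ψ x • fderiv ℝ η x) μ :=
    (hψ.continuous.smul hηd).integrable_of_hasCompactSupport hψc.smul_right
  rw [ContinuousLinearMap.integral_apply i1]
  refine integral_smul_fderiv_eq_neg_fderiv_smul_of_integrable ?_ ?_ ?_
    (fun x _ => hψ.differentiable one_ne_zero x) (fun x _ => hη.differentiable one_ne_zero x)
  · exact (hfd.smul hη.continuous).integrable_of_hasCompactSupport hfdc.smul_right
  · exact (hψ.continuous.smul (hηd.clm_apply continuous_const)).integrable_of_hasCompactSupport
      hψc.smul_right
  · exact (hψ.continuous.smul hη.continuous).integrable_of_hasCompactSupport hψc.smul_right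

/-- The weak gradient of an element of `W_0^{1,q}` is determined by integration by parts. -/
lemma integral_smul_snd_apply_eq [Fact (volume Ω < ⊤)] {S : Set (SobolevAmbient d Ω q)}
    (hS : S ⊆ sobolevZero Ω q) {φ : SobolevAmbient d Ω q} (hφ : φ ∈ Submodule.span ℝ S)
    {ψ : Vec d → ℝ} (hψ : ContDiff ℝ 1 ψ) (hψc : HasCompactSupport ψ) (v : Vec d) :
    (∫ x in Ω, ψ x • φ.2 x) v = -∫ x in Ω, (fderiv ℝ ψ x v) • φ.1 x := by
  have hfd : Continuous (fun x => fderiv ℝ ψ x v) :=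
    (hψ.continuous_fderiv one_ne_zero).clm_apply continuous_const
  have hfdc : HasCompactSupport (fun x => fderiv ℝ ψ x v) :=
    (hψc.fderiv ℝ).comp_left (g := fun A : Vec d →L[ℝ] ℝ => A v) rfl
  obtain ⟨C₁, hC₁⟩ := hψc.exists_bound_of_continuous hψ.continuous
  obtain ⟨C₂, hC₂⟩ := hfdc.exists_bound_of_continuous hfd
  obtain ⟨L₁, hL₁⟩ := exists_integralSMul (μ := vol Ω) (E := Vec d →L[ℝ] Mat d) (q := q)
    hψ.continuous.aestronglyMeasurable ((norm_nonneg _).trans (hC₁ 0)) hC₁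
  obtain ⟨L₂, hL₂⟩ := exists_integralSMul (μ := vol Ω) (E := Mat d) (q := q)
    hfd.aestronglyMeasurable ((norm_nonneg _).trans (hC₂ 0)) hC₂
  -- `T` is the defect in the integration by parts formula. It is linear and continuous, so its
  -- vanishing passes from test pairs to their closure and then to the span of `S`.
  let T : SobolevAmbient d Ω q →L[ℝ] Mat d :=
    ((ContinuousLinearMap.apply ℝ (Mat d) v).comp L₁).comp (ContinuousLinearMap.snd ℝ _ _) +
      L₂.comp (ContinuousLinearMap.fst ℝ _ _)
  have hT : ∀ g : SobolevAmbient d Ω q, T g = L₁ g.2 v + L₂ g.1 := fun g => rfl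
  have hclosed : IsClosed {g | T g = 0} := isClosed_eq T.continuous continuous_const
  have hsob : sobolevZero Ω q ⊆ {g | T g = 0} := by
    refine closure_minimal ?_ hclosed
    rintro g ⟨η, hη, -, hηΩ, h1, h2⟩
    have e1 : L₁ g.2 = ∫ x in Ω, ψ x • fderiv ℝ η x := by
      rw [hL₁]
      exact integral_congr_ae (h2.mono fun x hx => by simp only [hx])
    have e2 : L₂ g.1 = ∫ x in Ω, fderiv ℝ ψ x v • η x := by
      rw [hL₂]
      exact integral_congr_ae (h1.mono fun x hx => by simp only [hx])
    change T g = 0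
    rw [hT, e1, e2, setIntegral_smul_fderiv_eq
      (hη.of_le (by exact_mod_cast le_top)) hηΩ hψ hψc v, neg_add_cancel]
  have hspan : Submodule.span ℝ S ≤ T.toLinearMap.ker :=
    Submodule.span_le.2 fun g hg => hsob (hS hg)
  have h0 : T φ = 0 := hspan hφ
  rw [hT] at h0
  rw [← hL₁, ← hL₂]
  exact eq_neg_of_add_eq_zero_left h0

/-- The two components of the ambient space are a priori unrelated; integration by parts ties them
together. This makes the first projection injective on the span of `S`. -/
lemma eq_zero_of_fst_eq_zero [Fact (volume Ω < ⊤)] (hΩ : IsOpen Ω)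
    {S : Set (SobolevAmbient d Ω q)} (hS : S ⊆ sobolevZero Ω q) {φ : SobolevAmbient d Ω q}
    (hφ : φ ∈ Submodule.span ℝ S) (h : φ.1 = 0) : φ = 0 := by
  refine Prod.ext h ?_
  rw [Prod.snd_zero, Lp.eq_zero_iff_ae_eq_zero]
  have hint : Integrable φ.2 (vol Ω) := integrable_Lp φ.2
  have h1 : (φ.1 : Vec d → Mat d) =ᵐ[vol Ω] 0 := by rw [h]; exact Lp.coeFn_zero _ _ _
  have := hΩ.ae_eq_zero_of_integral_contDiff_smul_eq_zero (μ := vol Ω) (f := φ.2)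
    (hint.locallyIntegrable.locallyIntegrableOn Ω) fun ψ hψ hψc _ => by
      refine ContinuousLinearMap.ext fun v => ?_
      rw [integral_smul_snd_apply_eq hS hφ (hψ.of_le (by exact_mod_cast le_top)) hψc v,
        integral_eq_zero_of_ae, neg_zero]
      · rfl
      · filter_upwards [h1] with x hx
        rw [hx]
        exact smul_zero _
  filter_upwards [this, ae_restrict_mem hΩ.measurableSet] with x hx hx' using hx hx'

/-- On a finite-dimensional subspace of `W_0^{1,q}`, the `W^{1,q}` norm is controlled by the
`L^1` norm. -/
lemma exists_norm_le_integral_norm [Fact (volume Ω < ⊤)] (hΩ : IsOpen Ω)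
    {S : Set (SobolevAmbient d Ω q)} (hS : S ⊆ sobolevZero Ω q)
    (hSfin : FiniteDimensional ℝ (Submodule.span ℝ S)) :
    ∃ C : ℝ, 0 < C ∧ ∀ φ ∈ S, ‖φ‖ ≤ C * ∫ x in Ω, ‖φ.1 x‖ := by
  let L : Submodule.span ℝ S →ₗ[ℝ] Lp (Mat d) 1 (vol Ω) :=
    (toL1 (Mat d) (vol Ω) q).comp ((LinearMap.fst ℝ _ _).comp (Submodule.subtype _))
  -- An injective linear map on a finite-dimensional space is bounded below.
  obtain ⟨K, hK, hL⟩ := L.exists_antilipschitzWith (by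
    rw [LinearMap.ker_eq_bot']
    intro φ h
    have h1 : (φ : SobolevAmbient d Ω q).1 = 0 := toL1_eq_zero h
    exact Subtype.ext (eq_zero_of_fst_eq_zero hΩ hS φ.2 h1))
  refine ⟨K, hK, fun φ hφ => ?_⟩
  have := hL.le_mul_dist ⟨φ, Submodule.subset_span hφ⟩ 0
  rw [map_zero, dist_zero_right, dist_zero_right] at this
  refine this.trans_eq ?_
  rw [← norm_toL1]
  rfl

end Gradient

/-! ### The divergence -/

/-- The row-wise divergence as a linear map of the gradient. -/
def divCLM (d : ℕ) : (Vec d →L[ℝ] Mat d) →L[ℝ] Vec d :=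
  LinearMap.toContinuousLinearMap
    { toFun := fun A => WithLp.toLp 2 fun i => ∑ j, (A (EuclideanSpace.single j 1)) (i, j)
      map_add' := fun A B => by ext i; simp [Finset.sum_add_distrib]
      map_smul' := fun c A => by ext i; simp [Finset.mul_sum] }

lemma div_eq (φ : SobolevAmbient d Ω q) (x : Vec d) : div φ x = divCLM d (φ.2 x) := rfl

lemma integrable_div [Fact (1 ≤ q)] [Fact (volume Ω < ⊤)] (φ : SobolevAmbient d Ω q) :
    Integrable (div φ) (vol Ω) :=
  (divCLM d).integrable_comp (integrable_Lp φ.2)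

lemma div_sub (φ ψ : SobolevAmbient d Ω q) :
    div (φ - ψ) =ᵐ[vol Ω] fun x => div φ x - div ψ x :=
  (Lp.coeFn_sub φ.2 ψ.2).mono fun x hx => by
    simp only [div_eq, Prod.snd_sub, hx, Pi.sub_apply, map_sub]

lemma div_add_smul_sub (t : ℝ) (φ ψ : SobolevAmbient d Ω q) :
    div (φ + t • (ψ - φ)) =ᵐ[vol Ω] fun x => div φ x + t • (div ψ x - div φ x) := by
  filter_upwards [Lp.coeFn_add φ.2 (t • (ψ.2 - φ.2)), Lp.coeFn_smul t (ψ.2 - φ.2),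
    Lp.coeFn_sub ψ.2 φ.2] with x h1 h2 h3
  simp only [div_eq, Prod.snd_add, Prod.smul_snd, Prod.snd_sub, h1, Pi.add_apply, h2,
    Pi.smul_apply, h3, Pi.sub_apply, map_add, map_smul, map_sub]

lemma exists_integral_norm_div_le (Ω : Set (Vec d)) (q : ℝ≥0∞) [Fact (1 ≤ q)]
    [Fact (volume Ω < ⊤)] :
    ∃ C : ℝ, 0 ≤ C ∧ ∀ φ : SobolevAmbient d Ω q, ∫ x in Ω, ‖div φ x‖ ≤ C * ‖φ‖ := by
  obtain ⟨D, hD, hD'⟩ := exists_integral_norm_le (Vec d →L[ℝ] Mat d) (vol Ω) q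
  refine ⟨‖divCLM d‖ * D, by positivity, fun φ => ?_⟩
  calc ∫ x in Ω, ‖div φ x‖ ≤ ∫ x in Ω, ‖divCLM d‖ * ‖φ.2 x‖ :=
        integral_mono (integrable_div φ).norm ((integrable_Lp φ.2).norm.const_mul _)
          fun x => (divCLM d).le_opNorm _
    _ = ‖divCLM d‖ * ∫ x in Ω, ‖φ.2 x‖ := integral_const_mul _ _
    _ ≤ ‖divCLM d‖ * (D * ‖φ.2‖) := by gcongr; exact hD' _
    _ ≤ ‖divCLM d‖ * (D * ‖φ‖) := by gcongr; exact norm_snd_le φ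
    _ = _ := by ring

end Sobolev

/-! ### The density cost -/

section DensityCost

variable {H : ℝ → ℝ}

lemma AssumptionA2.continuousOn (hH : AssumptionA2 H) : ContinuousOn H (Ioi 0) :=
  hH.contDiff.continuousOn

/-- Sublevel sets of `H` relative to an affine function are compactly contained in `(0, ∞)`. -/
lemma AssumptionA2.exists_confine (hH : AssumptionA2 H) (K : ℝ) :
    ∃ δ B : ℝ, 0 < δ ∧ δ ≤ 1 ∧ 1 ≤ B ∧ ∀ t, 0 < t → H t ≤ K + K * t → t ∈ Icc δ B := by
  -- The threshold 2|K| + 1 exceeds K + K t when t ≤ 1, and its product with t does so when t ≥ 1.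
  obtain ⟨B, hB⟩ := eventually_atTop.1 (hH.tendsto_infty.eventually_ge_atTop (2 * |K| + 1))
  obtain ⟨δ, hδ0, hδ⟩ := mem_nhdsGT_iff_exists_Ioo_subset.1
    (hH.tendsto_zero.eventually_ge_atTop (2 * |K| + 1))
  have hδ0' : 0 < δ := hδ0
  refine ⟨min δ 1, max B 1, lt_min hδ0' one_pos, min_le_right _ _, le_max_right _ _,
    fun t ht h => ⟨?_, ?_⟩⟩
  · by_contra hcon
    push Not at hcon
    have h1 : 2 * |K| + 1 ≤ H t := hδ ⟨ht, hcon.trans_le (min_le_left _ _)⟩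
    have h2 : t ≤ 1 := (hcon.trans_le (min_le_right _ _)).le
    have h3 : K * t ≤ |K| := by
      calc K * t ≤ |K| * t := by gcongr; exact le_abs_self K
        _ ≤ |K| * 1 := by gcongr
        _ = |K| := mul_one _
    linarith [le_abs_self K]
  · by_contra hcon
    push Not at hcon
    have h1 := hB t ((le_max_left _ _).trans hcon.le)
    have h2 : 1 ≤ t := (le_max_right _ _).trans hcon.le
    rw [le_div_iff₀ ht] at h1
    have h3 : K * t ≤ |K| * t := by gcongr; exact le_abs_self K
    nlinarith [le_abs_self K, abs_nonneg K]

lemma AssumptionA2.exists_linear_le (hH : AssumptionA2 H) (M : ℝ) :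
    ∃ C : ℝ, ∀ t, 0 < t → M * t - C ≤ H t := by
  obtain ⟨δ, B, hδ, -, -, hc⟩ := hH.exists_confine |M|
  have hsub : Icc δ B ⊆ Ioi 0 := fun t ht => hδ.trans_le ht.1
  obtain ⟨C, hC⟩ := isCompact_Icc.bddBelow_image (f := fun t => H t - M * t)
    ((hH.continuousOn.mono hsub).sub (by fun_prop))
  refine ⟨max (-C) 0, fun t ht => ?_⟩
  by_cases h : H t ≤ |M| + |M| * t
  · have : C ≤ H t - M * t := hC (mem_image_of_mem _ (hc t ht h))
    linarith [le_max_left (-C) 0]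
  · push Not at h
    have h3 : M * t ≤ |M| * t := by gcongr; exact le_abs_self M
    linarith [le_max_right (-C) 0, abs_nonneg M]

/-- `t` maximizes `(s - H t) / t` over the positive reals. -/
def IsOptDensity (H : ℝ → ℝ) (s t : ℝ) : Prop :=
  0 < t ∧ ∀ t', 0 < t' → (s - H t') / t' ≤ (s - H t) / t

/-- The maximizer of `(s - H t) / t` over the positive reals. -/
def optDensity (H : ℝ → ℝ) (s : ℝ) : ℝ := Classical.epsilon (IsOptDensity H s)

/-- The problem arises with s = u · v - k(v), where the constraint k(v) ≥ u · v - H(t) - t l(u)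
reads (s - H(t))/t ≤ l(u). Wherever the quotient exceeds its value at t = 1, `H` lies below an
affine function, which confines t to a compact interval. -/
lemma AssumptionA2.exists_isOptDensity (hH : AssumptionA2 H) (s : ℝ) :
    ∃ t, IsOptDensity H s t := by
  set c := s - H 1
  obtain ⟨δ, B, hδ, hδ1, hB1, hc⟩ := hH.exists_confine (|s| + |c|)
  have hsub : Icc δ B ⊆ Ioi 0 := fun t ht => hδ.trans_le ht.1
  obtain ⟨t, ht, hmax⟩ := isCompact_Icc.exists_isMaxOn (nonempty_Icc.2 (hδ1.trans hB1))
    (f := fun t => (s - H t) / t)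
    ((continuousOn_const.sub (hH.continuousOn.mono hsub)).div continuousOn_id
      fun t ht => (hsub ht).ne')
  refine ⟨t, hsub ht, fun t' ht' => ?_⟩
  by_cases h : (s - H t') / t' ≤ c
  · refine h.trans ?_
    have : (s - H 1) / 1 ≤ (s - H t) / t := hmax (show (1 : ℝ) ∈ Icc δ B from ⟨hδ1, hB1⟩)
    rwa [div_one] at this
  · push Not at h
    refine hmax (hc t' ht' ?_)
    rw [lt_div_iff₀ ht'] at h
    have h3 : -c * t' ≤ |c| * t' := by gcongr; exact neg_le_abs c
    nlinarith [le_abs_self s, mul_nonneg (abs_nonneg s) ht'.le, abs_nonneg c]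

lemma AssumptionA2.isOptDensity_optDensity (hH : AssumptionA2 H) (s : ℝ) :
    IsOptDensity H s (optDensity H s) :=
  Classical.epsilon_spec (hH.exists_isOptDensity s)

lemma AssumptionA2.optDensity_pos (hH : AssumptionA2 H) (s : ℝ) : 0 < optDensity H s :=
  (hH.isOptDensity_optDensity s).1

/-- Two maximizers with common value c satisfy s - H(t) = c t. If they were distinct, strict
convexity would give a larger quotient at their midpoint. -/
lemma AssumptionA2.eq_optDensity (hH : AssumptionA2 H) {s t : ℝ} (h : IsOptDensity H s t) :
    t = optDensity H s := by
  by_contra hne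
  set t' := optDensity H s
  have h' := hH.isOptDensity_optDensity s
  obtain ⟨c, hc⟩ : ∃ c, c = (s - H t) / t := ⟨_, rfl⟩
  have hc' : c = (s - H t') / t' := hc.trans (le_antisymm (h'.2 t h.1) (h.2 t' h'.1))
  have hm : 0 < (1 / 2 : ℝ) • t + (1 / 2 : ℝ) • t' := by
    have := h.1; have := h'.1
    simp only [smul_eq_mul]; linarith
  have hs := hH.strictConvex.2 (mem_Ioi.2 h.1) (mem_Ioi.2 h'.1) hne (by norm_num : (0 : ℝ) < 1 / 2)
    (by norm_num : (0 : ℝ) < 1 / 2) (by norm_num)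
  have hle := h.2 _ hm
  rw [← hc, div_le_iff₀ hm] at hle
  rw [eq_div_iff h.1.ne'] at hc
  rw [eq_div_iff h'.1.ne'] at hc'
  simp only [smul_eq_mul] at hs hle
  linarith

/-- Adding the two optimality inequalities gives (s' - s)(1/t - 1/t') ≤ 0. Monotonicity supplies the
measurability of a function defined by choice. -/
lemma AssumptionA2.antitone_optDensity (hH : AssumptionA2 H) : Antitone (optDensity H) := by
  intro s s' hss
  rcases hss.eq_or_lt with rfl | hlt
  · exact le_rfl
  have h := hH.isOptDensity_optDensity s
  have h' := hH.isOptDensity_optDensity s'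
  set t := optDensity H s
  set t' := optDensity H s'
  have h1 := h.2 t' h'.1
  have h2 := h'.2 t h.1
  by_contra hcon
  push Not at hcon
  have h3 : 1 / t' < 1 / t := one_div_lt_one_div_of_lt h.1 hcon
  have e : ∀ a b c : ℝ, (a - b) / c = a * (1 / c) - b * (1 / c) := fun a b c => by ring
  simp only [e] at h1 h2
  nlinarith [mul_pos (sub_pos.2 hlt) (sub_pos.2 h3)]

lemma AssumptionA2.measurable_optDensity (hH : AssumptionA2 H) : Measurable (optDensity H) :=
  hH.antitone_optDensity.measurable

/-- Stability of the maximizer of `(s - H t) / t`. -/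
lemma AssumptionA2.tendsto_optDensity (hH : AssumptionA2 H) {s : ℝ} {a b t : ℕ → ℝ}
    (ha : Tendsto a atTop (𝓝 s)) (hb : Tendsto b atTop (𝓝 s)) (ht : ∀ n, 0 < t n)
    (h : ∀ n, ∀ t', 0 < t' → (a n - H t') / t' ≤ (b n - H (t n)) / t n) :
    Tendsto t atTop (𝓝 (optDensity H s)) := by
  obtain ⟨A, hA⟩ := ha.bddBelow_range
  obtain ⟨B, hB⟩ := hb.bddAbove_range
  set c := A - H 1
  obtain ⟨δ, D, hδ, -, -, hc⟩ := hH.exists_confine (|B| + |c|)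
  -- Comparison with the competitor t' = 1 confines the sequence to a compact subset of (0, ∞).
  have hmem : ∀ n, t n ∈ Icc δ D := fun n => by
    refine hc _ (ht n) ?_
    have h1 := h n 1 one_pos
    rw [div_one, le_div_iff₀ (ht n)] at h1
    have h2 : b n ≤ B := hB (mem_range_self n)
    have h3 : A ≤ a n := hA (mem_range_self n)
    have h4 : c * t n ≤ (a n - H 1) * t n :=
      mul_le_mul_of_nonneg_right (by simp only [c]; linarith) (ht n).le
    have h5 : -c * t n ≤ |c| * t n := by
      have := ht n
      gcongr; exact neg_le_abs c
    nlinarith [le_abs_self B, mul_nonneg (abs_nonneg B) (ht n).le, abs_nonneg c]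
  -- Every cluster point is a maximizer, and the maximizer is unique.
  refine isCompact_Icc.tendsto_nhds_of_unique_mapClusterPt (Eventually.of_forall hmem)
    fun x hx hcl => hH.eq_optDensity ?_
  have hx0 : 0 < x := hδ.trans_le hx.1
  obtain ⟨𝓤, h𝓤, hlim⟩ := mapClusterPt_iff_ultrafilter.1 hcl
  refine ⟨hx0, fun t' ht' => ?_⟩
  have hHx : Tendsto (fun n => H (t n)) 𝓤 (𝓝 (H x)) :=
    (hH.continuousOn.continuousAt (Ioi_mem_nhds hx0)).tendsto.comp hlim
  exact le_of_tendsto_of_tendsto' (((ha.mono_left h𝓤).sub_const _).div_const _)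
    (((hb.mono_left h𝓤).sub hHx).div hlim hx0.ne') fun n => h n t' ht'

end DensityCost

/-! ### Approximate subgradients -/

/-- Approximate subgradients at a point of differentiability converge to the gradient. -/
lemma tendsto_gradient {E : Type*} [NormedAddCommGroup E] [InnerProductSpace ℝ E] [CompleteSpace E]
    {k : E → ℝ} {v : E} (hk : DifferentiableAt ℝ k v) {u : ℕ → E} {δ : ℕ → ℝ}
    (hδ : Tendsto δ atTop (𝓝 0)) (h : ∀ n w, k v + inner ℝ (u n) (w - v) - δ n ≤ k w) :
    Tendsto u atTop (𝓝 (gradient k v)) := by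
  set g := gradient k v
  have hg := hk.hasGradientAt
  rw [hasGradientAt_iff_isLittleO] at hg
  rw [Metric.tendsto_atTop']
  intro ε hε
  have hev := hg.def (half_pos hε)
  obtain ⟨ρ, hρ, hball⟩ := Metric.eventually_nhds_iff_ball.1 hev
  obtain ⟨N, hN⟩ := (Metric.tendsto_atTop'.1 hδ) (ε / 2 * (ρ / 2)) (by positivity)
  refine ⟨N, fun n hn => ?_⟩
  rw [dist_eq_norm]
  by_contra hcon
  push Not at hcon
  have hpos : 0 < ‖u n - g‖ := hε.trans_le hcon
  -- A step of length ρ/2 towards u n - g: the linear gain ρ/2 · ‖u n - g‖ must stay below the sum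
  -- of the differentiability error and `δ n`, each at most ε/2 · ρ/2, the latter strictly.
  set z := (ρ / 2 / ‖u n - g‖) • (u n - g)
  have hz : ‖z‖ = ρ / 2 := by
    rw [norm_smul, Real.norm_of_nonneg (by positivity), div_mul_cancel₀ _ hpos.ne']
  have h1 := hball (v + z) (by
    rw [Metric.mem_ball, dist_eq_norm, add_sub_cancel_left, hz]; linarith)
  have h2 := h n (v + z)
  rw [add_sub_cancel_left] at h1 h2
  rw [hz, Real.norm_eq_abs] at h1
  have h3 := le_of_abs_le h1
  have h4 : inner ℝ (u n) z - inner ℝ g z = ρ / 2 * ‖u n - g‖ := by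
    rw [← inner_sub_left, inner_smul_right, real_inner_self_eq_norm_sq]
    field_simp
  have h5 := hN n hn
  rw [Real.dist_eq, sub_zero] at h5
  have h6 := lt_of_abs_lt h5
  have h7 : ρ / 2 * ε ≤ ρ / 2 * ‖u n - g‖ := by gcongr
  linarith

/-! ### The conjugate of a potential -/

section Conj

variable {E : Type*} [NormedAddCommGroup E] [InnerProductSpace ℝ E]

/-- The function `v ↦ sup {u · v - H(t) - t l(u) : u ∈ U, t > 0}`. -/
def conj (H : ℝ → ℝ) (U : Set E) (l : E → ℝ) (v : E) : ℝ :=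
  ⨆ w : U × Ioi (0 : ℝ), (inner ℝ (w.1 : E) v - H w.2 - w.2 * l w.1)

variable {H : ℝ → ℝ} {U : Set E} {R : ℝ} {l : E → ℝ}

/-- The superlinear growth of `H` absorbs -t l(u), as l is bounded below. Without boundedness the
real supremum in `conj` would take its default value 0. -/
lemma bddAbove_conj (hH : AssumptionA2 H) (hU : U ⊆ Metric.closedBall 0 R)
    (hl : BddBelow (l '' U)) (v : E) :
    BddAbove (range fun w : U × Ioi (0 : ℝ) => inner ℝ (w.1 : E) v - H w.2 - w.2 * l w.1) := by
  obtain ⟨M, hM⟩ := hl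
  obtain ⟨C, hC⟩ := hH.exists_linear_le (-M)
  refine ⟨R * ‖v‖ + C, ?_⟩
  rintro _ ⟨⟨⟨u, hu⟩, ⟨t, ht⟩⟩, rfl⟩
  have h1 : inner ℝ u v ≤ R * ‖v‖ := (real_inner_le_norm _ _).trans (by
    gcongr; simpa using hU hu)
  have h2 : t * M ≤ t * l u := mul_le_mul_of_nonneg_left (hM (mem_image_of_mem _ hu)) ht.le
  have h3 := hC t ht
  simp only
  linarith

lemma le_conj (hH : AssumptionA2 H) (hU : U ⊆ Metric.closedBall 0 R) (hl : BddBelow (l '' U))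
    {u : E} (hu : u ∈ U) {t : ℝ} (ht : 0 < t) (v : E) :
    inner ℝ u v - H t - t * l u ≤ conj H U l v :=
  le_ciSup (bddAbove_conj hH hU hl v) (⟨⟨u, hu⟩, ⟨t, ht⟩⟩ : U × Ioi (0 : ℝ))

lemma conj_le (hUn : U.Nonempty) {v : E} {c : ℝ}
    (h : ∀ u ∈ U, ∀ t, 0 < t → inner ℝ u v - H t - t * l u ≤ c) : conj H U l v ≤ c := by
  have : Nonempty U := hUn.to_subtype
  exact ciSup_le fun w => h _ w.1.2 _ w.2.2

lemma exists_conj_lt (hUn : U.Nonempty) (l : E → ℝ) (v : E) {ε : ℝ} (hε : 0 < ε) :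
    ∃ u ∈ U, ∃ t, 0 < t ∧ conj H U l v - ε < inner ℝ u v - H t - t * l u := by
  have : Nonempty U := hUn.to_subtype
  obtain ⟨w, hw⟩ := exists_lt_of_lt_ciSup (show conj H U l v - ε < _ from sub_lt_self _ hε)
  exact ⟨_, w.1.2, _, w.2.2, hw⟩

lemma conj_le_add (hH : AssumptionA2 H) (hU : U ⊆ Metric.closedBall 0 R) (hUn : U.Nonempty)
    (hl : BddBelow (l '' U)) (v w : E) :
    conj H U l v ≤ conj H U l w + R * ‖v - w‖ := by
  refine conj_le hUn fun u hu t ht => ?_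
  have h1 := le_conj hH hU hl hu ht w
  have h2 : inner ℝ u (v - w) ≤ R * ‖v - w‖ := (real_inner_le_norm _ _).trans (by
    gcongr; simpa using hU hu)
  rw [inner_sub_right] at h2
  linarith

lemma abs_conj_sub_le (hH : AssumptionA2 H) (hU : U ⊆ Metric.closedBall 0 R) (hUn : U.Nonempty)
    (hl : BddBelow (l '' U)) (v w : E) :
    |conj H U l v - conj H U l w| ≤ R * ‖v - w‖ := by
  have h1 := conj_le_add hH hU hUn hl v w
  have h2 := conj_le_add hH hU hUn hl w v
  rw [norm_sub_rev] at h2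
  exact abs_le.2 ⟨by linarith, by linarith⟩

lemma lipschitzWith_conj (hH : AssumptionA2 H) (hU : U ⊆ Metric.closedBall 0 R) (hUn : U.Nonempty)
    (hl : BddBelow (l '' U)) : LipschitzWith R.toNNReal (conj H U l) := by
  refine LipschitzWith.of_dist_le_mul fun v w => ?_
  rw [Real.dist_eq, dist_eq_norm]
  refine (abs_conj_sub_le hH hU hUn hl v w).trans ?_
  gcongr
  exact Real.le_coe_toNNReal R

lemma bddBelow_add_mul {X : Type*} {U : Set X} {l η : X → ℝ} {C : ℝ} (hη : ∀ u, |η u| ≤ C) (hl : BddBelow (l '' U)) (ε : ℝ) :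
    BddBelow ((fun u => l u + ε * η u) '' U) := by
  obtain ⟨M, hM⟩ := hl
  refine ⟨M - |ε| * C, ?_⟩
  rintro _ ⟨u, hu, rfl⟩
  have h1 : |ε * η u| ≤ |ε| * C := by rw [abs_mul]; gcongr; exact hη u
  have h2 := hM (mem_image_of_mem _ hu)
  have h3 := neg_le_of_abs_le h1
  simp only
  linarith

variable {η : E → ℝ} {C : ℝ}

/-- As a supremum of functions affine in l, the conjugate is convex in l; here l + ε η lies on the
segment from l to l + η. The bound controls slopes uniformly in ε. -/
lemma conj_add_mul_le (hH : AssumptionA2 H) (hU : U ⊆ Metric.closedBall 0 R) (hUn : U.Nonempty)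
    (hl : BddBelow (l '' U)) (hη : ∀ u, |η u| ≤ C) (v : E) {ε : ℝ} (h0 : 0 ≤ ε) (h1 : ε ≤ 1) :
    conj H U (fun u => l u + ε * η u) v ≤
      (1 - ε) * conj H U l v + ε * conj H U (fun u => l u + η u) v := by
  refine conj_le hUn fun u hu t ht => ?_
  have hl' : BddBelow ((fun u => l u + η u) '' U) := by simpa using bddBelow_add_mul hη hl 1
  have e1 := mul_le_mul_of_nonneg_left (le_conj hH hU hl hu ht v) (sub_nonneg.2 h1)
  have e2 := mul_le_mul_of_nonneg_left (le_conj hH hU hl' hu ht v) h0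
  linarith

/-- Midpoint convexity in the potential: l is the mean of l + ε η and l - ε η. -/
lemma two_mul_conj_le (hH : AssumptionA2 H) (hU : U ⊆ Metric.closedBall 0 R) (hUn : U.Nonempty)
    (hl : BddBelow (l '' U)) (hη : ∀ u, |η u| ≤ C) (v : E) (ε : ℝ) :
    2 * conj H U l v ≤ conj H U (fun u => l u + ε * η u) v +
      conj H U (fun u => l u + ε * -η u) v := by
  suffices conj H U l v ≤ (conj H U (fun u => l u + ε * η u) v +
      conj H U (fun u => l u + ε * -η u) v) / 2 by linarith
  refine conj_le hUn fun u hu t ht => ?_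
  have e1 := le_conj hH hU (bddBelow_add_mul hη hl ε) hu ht v
  have e2 := le_conj hH hU (bddBelow_add_mul (η := fun u => -η u) (by simpa using hη) hl ε) hu ht v
  linarith

variable [CompleteSpace E]

/-- Maximizing sequences in the definition of the conjugate converge at points of
differentiability. -/
lemma tendsto_of_tendsto_conj (hH : AssumptionA2 H) (hU : U ⊆ Metric.closedBall 0 R)
    (hl : BddBelow (l '' U)) {v : E} (hv : DifferentiableAt ℝ (conj H U l) v)
    {u : ℕ → E} {t : ℕ → ℝ} (hu : ∀ n, u n ∈ U) (ht : ∀ n, 0 < t n)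
    (h : Tendsto (fun n => inner ℝ (u n) v - H (t n) - t n * l (u n)) atTop
      (𝓝 (conj H U l v))) :
    Tendsto u atTop (𝓝 (gradient (conj H U l) v)) ∧
    Tendsto t atTop
      (𝓝 (optDensity H (inner ℝ (gradient (conj H U l) v) v - conj H U l v))) ∧
    Tendsto (fun n => t n * l (u n) + H (t n)) atTop
      (𝓝 (inner ℝ (gradient (conj H U l) v) v - conj H U l v)) := by
  have hug : Tendsto u atTop (𝓝 (gradient (conj H U l) v)) := by
    have hδ := h.const_sub (conj H U l v)
    rw [sub_self] at hδ
    -- Near-maximizers are approximate subgradients, with error the gap to the supremum.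
    refine tendsto_gradient hv hδ fun n w => ?_
    have := le_conj hH hU hl (hu n) (ht n) w
    rw [inner_sub_right]
    linarith
  have hin : Tendsto (fun n => inner ℝ (u n) v) atTop
      (𝓝 (inner ℝ (gradient (conj H U l) v) v)) := hug.inner tendsto_const_nhds
  have hb : Tendsto (fun n => t n * l (u n) + H (t n)) atTop
      (𝓝 (inner ℝ (gradient (conj H U l) v) v - conj H U l v)) := by
    refine (hin.sub h).congr fun n => ?_
    ring
  refine ⟨hug, ?_, hb⟩
  -- The inequality defining the conjugate bounds (a n - H(t'))/t' by l(u n), and l(u n) is the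
  -- quotient for b n = t n l(u n) + H(t n) at t n.
  refine hH.tendsto_optDensity (hin.sub_const (conj H U l v)) hb ht fun n t' ht' => ?_
  have e : (t n * l (u n) + H (t n) - H (t n)) / t n = l (u n) := by
    rw [add_sub_cancel_right, mul_div_cancel_left₀ _ (ht n).ne']
  rw [e, div_le_iff₀ ht']
  have := le_conj hH hU hl (hu n) ht' v
  linarith

/-- Near-maximizers for the perturbed potential also form a maximizing sequence for `l`, hence
converge. Testing `l` with them bounds the slope by -η(u) t plus an error. Near-maximality up to ε²
leaves only ε after division by ε. -/
lemma exists_upper_slope (hH : AssumptionA2 H) (hU : U ⊆ Metric.closedBall 0 R) (hUn : U.Nonempty)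
    (hl : BddBelow (l '' U)) (hη : ∀ u, |η u| ≤ C) (hηc : Continuous η) {v : E}
    (hv : DifferentiableAt ℝ (conj H U l) v) {ε : ℕ → ℝ} (hε0 : ∀ n, 0 < ε n)
    (hε1 : ∀ n, ε n < 1) (hε : Tendsto ε atTop (𝓝 0)) :
    ∃ b : ℕ → ℝ, Tendsto b atTop (𝓝 (-(η (gradient (conj H U l) v) *
        optDensity H (inner ℝ (gradient (conj H U l) v) v - conj H U l v)))) ∧
      ∀ n, conj H U (fun u => l u + ε n * η u) v - conj H U l v ≤ ε n * b n := by
  choose u hu t ht hut using fun n => exists_conj_lt (H := H) hUn (fun u => l u + ε n * η u) v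
    (pow_pos (hε0 n) 2)
  set K := conj H U l v
  have hη' : ∀ u, |-η u| ≤ C := by simpa using hη
  set K₁ := conj H U (fun u => l u + η u) v with hK₁
  set K₂ := conj H U (fun u => l u + -η u) v with hK₂
  have hlow : ∀ n, K + ε n * (K - K₂) ≤ conj H U (fun u => l u + ε n * η u) v := fun n => by
    have h1 := two_mul_conj_le hH hU hUn hl hη v (ε n)
    have h2 := conj_add_mul_le hH hU hUn hl hη' v (hε0 n).le (hε1 n).le
    linarith
  have hval : ∀ n, K + ε n * (K - K₂) - ε n ^ 2 ≤
      inner ℝ (u n) v - H (t n) - t n * (l (u n) + ε n * η (u n)) := fun n => by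
    linarith [hlow n, hut n]
  have hl' : BddBelow ((fun u => l u + η u) '' U) := by simpa using bddBelow_add_mul hη hl 1
  -- The sequence `t n` is not yet known to be bounded, so ε t η(u) is not estimated directly. The
  -- perturbed value is instead (1 - ε) times the value for l plus ε times the value for l + η, and
  -- the latter is at most `K₁`.
  have hval0 : ∀ n, (K + ε n * (K - K₂) - ε n ^ 2 - ε n * K₁) / (1 - ε n) ≤
      inner ℝ (u n) v - H (t n) - t n * l (u n) := fun n => by
    rw [div_le_iff₀ (by linarith [hε1 n])]
    have h1 := mul_le_mul_of_nonneg_left (le_conj hH hU hl' (hu n) (ht n) v) (hε0 n).le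
    linarith [hval n]
  have hlim : Tendsto (fun n => (K + ε n * (K - K₂) - ε n ^ 2 - ε n * K₁) / (1 - ε n)) atTop
      (𝓝 K) := by
    have h1 := (((hε.mul_const (K - K₂)).const_add K).sub (hε.pow 2)).sub (hε.mul_const K₁)
    have h2 := h1.div (hε.const_sub 1) (by norm_num)
    convert h2 using 2 <;> first | rfl | ring
  have hconv := tendsto_of_tendsto_conj hH hU hl hv hu ht
    (tendsto_of_tendsto_of_tendsto_of_le_of_le hlim tendsto_const_nhds hval0
      fun n => le_conj hH hU hl (hu n) (ht n) v)
  refine ⟨fun n => -(η (u n) * t n) + ε n, ?_, fun n => ?_⟩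
  · have := ((((hηc.tendsto _).comp hconv.1).mul hconv.2.1).neg).add hε
    simpa using this
  · have h1 := hut n
    have h2 := le_conj hH hU hl (hu n) (ht n) v
    linarith

/-- The derivative of the conjugate with respect to the potential. -/
lemma tendsto_conj_slope (hH : AssumptionA2 H) (hU : U ⊆ Metric.closedBall 0 R) (hUn : U.Nonempty)
    (hl : BddBelow (l '' U)) (hη : ∀ u, |η u| ≤ C) (hηc : Continuous η) {v : E}
    (hv : DifferentiableAt ℝ (conj H U l) v) {ε : ℕ → ℝ} (hε0 : ∀ n, 0 < ε n)
    (hε1 : ∀ n, ε n < 1) (hε : Tendsto ε atTop (𝓝 0)) :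
    Tendsto (fun n => (conj H U (fun u => l u + ε n * η u) v - conj H U l v) / ε n) atTop
      (𝓝 (-(η (gradient (conj H U l) v) *
        optDensity H (inner ℝ (gradient (conj H U l) v) v - conj H U l v)))) := by
  obtain ⟨b, hb, hb'⟩ := exists_upper_slope hH hU hUn hl hη hηc hv hε0 hε1 hε
  -- The upper slope for -η becomes a lower slope for η by midpoint convexity.
  obtain ⟨c, hc, hc'⟩ := exists_upper_slope (η := fun u => -η u) hH hU hUn hl (by simpa using hη)
    hηc.neg hv hε0 hε1 hε
  have hc2 := hc.neg
  rw [neg_mul, neg_neg] at hc2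
  refine tendsto_of_tendsto_of_tendsto_of_le_of_le hc2 hb (fun n => ?_) fun n => ?_
  · simp only
    rw [le_div_iff₀ (hε0 n)]
    have := two_mul_conj_le hH hU hUn hl hη v (ε n)
    linarith [hc' n]
  · simp only
    rw [div_le_iff₀ (hε0 n)]
    linarith [hb' n]

end Conj

/-! ### The potential recovered from its conjugate -/

section Potential

variable {E : Type*} [NormedAddCommGroup E] [InnerProductSpace ℝ E]

/-- The least potential `l` with `k(v) + t l(u) ≥ u · v - H(t)` for all `v` and `t > 0`. -/
def potential (H : ℝ → ℝ) (k : E → ℝ) (u : E) : EReal :=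
  ⨆ w : E × Ioi (0 : ℝ), (((inner ℝ u w.1 - H w.2 - k w.1) / w.2 : ℝ) : EReal)

variable {H : ℝ → ℝ} {k : E → ℝ}

lemma le_potential (H : ℝ → ℝ) (k : E → ℝ) (u v : E) {t : ℝ} (ht : 0 < t) :
    (((inner ℝ u v - H t - k v) / t : ℝ) : EReal) ≤ potential H k u :=
  le_iSup (fun w : E × Ioi (0 : ℝ) => (((inner ℝ u w.1 - H w.2 - k w.1) / w.2 : ℝ) : EReal))
    (v, ⟨t, ht⟩)

lemma potential_ne_bot (u : E) : potential H k u ≠ ⊥ := by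
  intro h
  exact EReal.coe_ne_bot _ (le_bot_iff.1 ((le_potential H k u 0 one_pos).trans_eq h))

lemma measurable_potential [MeasurableSpace E] [BorelSpace E] : Measurable (potential H k) := by
  unfold potential
  refine LowerSemicontinuous.measurable (lowerSemicontinuous_iSup fun w => ?_)
  refine Continuous.lowerSemicontinuous ?_
  exact continuous_coe_real_ereal.comp (by fun_prop)

lemma potential_combo_le {u u' : E} {a b : ℝ} (ha : 0 ≤ a) (hb : 0 ≤ b) (hab : a + b = 1)
    {s s' : ℝ} (hu : potential H k u ≤ s) (hu' : potential H k u' ≤ s') :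
    potential H k (a • u + b • u') ≤ ((a * s + b * s' : ℝ) : EReal) := by
  refine iSup_le fun w => EReal.coe_le_coe_iff.2 ?_
  have h1 := EReal.coe_le_coe_iff.1 ((le_potential H k u w.1 w.2.2).trans hu)
  have h2 := EReal.coe_le_coe_iff.1 ((le_potential H k u' w.1 w.2.2).trans hu')
  have h3 := mul_le_mul_of_nonneg_left h1 ha
  have h4 := mul_le_mul_of_nonneg_left h2 hb
  have e : (inner ℝ (a • u + b • u') w.1 - H w.2 - k w.1) / w.2 =
      a * ((inner ℝ u w.1 - H w.2 - k w.1) / w.2) +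
        b * ((inner ℝ u' w.1 - H w.2 - k w.1) / w.2) := by
    rw [inner_add_left, real_inner_smul_left, real_inner_smul_left]
    obtain rfl : b = 1 - a := by linarith
    ring
  linarith

lemma coe_toReal_potential {u : E} (h : potential H k u ≠ ⊤) :
    ((potential H k u).toReal : EReal) = potential H k u :=
  EReal.coe_toReal h (potential_ne_bot u)

/-- A potential which is finite almost everywhere on an open set is finite there. -/
lemma potential_ne_top [FiniteDimensional ℝ E] [MeasurableSpace E] [BorelSpace E] {U : Set E}
    (hU : IsOpen U)
    (h : ∀ᵐ u ∂(volume.restrict U), potential H k u ≠ ⊤) {u : E} (hu : u ∈ U) :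
    potential H k u ≠ ⊤ := by
  rw [ae_restrict_iff' hU.measurableSet] at h
  -- The reflection through u preserves null sets, so some x near u has finite potential together
  -- with 2u - x; convexity then bounds the value at their midpoint u.
  have h' := (Measure.measurePreserving_sub_left (volume : Measure E) (u + u)).quasiMeasurePreserving.ae h
  obtain ⟨ρ, hρ, hball⟩ := Metric.isOpen_iff.1 hU u hu
  obtain ⟨x, hx, hx1, hx2⟩ := (Measure.dense_of_ae (h.and h')).inter_open_nonempty _
    Metric.isOpen_ball ⟨u, Metric.mem_ball_self hρ⟩
  have hx' : u + u - x ∈ Metric.ball u ρ := by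
    rw [Metric.mem_ball, dist_eq_norm, show u + u - x - u = u - x by abel, ← dist_eq_norm, dist_comm]
    exact hx
  have e1 := (coe_toReal_potential (hx1 (hball hx))).ge
  have e2 := (coe_toReal_potential (hx2 (hball hx'))).ge
  have := potential_combo_le (by norm_num : (0 : ℝ) ≤ 1 / 2) (by norm_num : (0 : ℝ) ≤ 1 / 2)
    (by norm_num) e1 e2
  rw [← smul_add, add_sub_cancel, ← two_smul ℝ u, smul_smul] at this
  norm_num at this
  exact (this.trans_lt (EReal.coe_lt_top _)).ne

lemma convexOn_toReal_potential {U : Set E} (hU : Convex ℝ U)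
    (h : ∀ u ∈ U, potential H k u ≠ ⊤) : ConvexOn ℝ U (fun u => (potential H k u).toReal) := by
  refine ⟨hU, fun u hu u' hu' a b ha hb hab => ?_⟩
  have := potential_combo_le ha hb hab (coe_toReal_potential (h u hu)).ge
    (coe_toReal_potential (h u' hu')).ge
  rw [← coe_toReal_potential (h _ (hU hu hu' ha hb hab)), EReal.coe_le_coe_iff] at this
  simpa using this

/-- This is why passing to the potential of a limit k does not raise the transport term of the dual
functional. -/
lemma conj_toReal_potential_le {U : Set E} (hUn : U.Nonempty)
    (h : ∀ u ∈ U, potential H k u ≠ ⊤) (v : E) :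
    conj H U (fun u => (potential H k u).toReal) v ≤ k v := by
  refine conj_le hUn fun u hu t ht => ?_
  have := le_potential H k u v ht
  rw [← coe_toReal_potential (h u hu), EReal.coe_le_coe_iff, div_le_iff₀ ht] at this
  linarith

/-- The single number `conj H U l 0` bounds l below on `U`, uniformly in u; this drives the
coercivity and the lower bounds needed for Fatou's lemma. -/
lemma conj_zero_lower {U : Set E} {R : ℝ} {l : E → ℝ} (hH : AssumptionA2 H)
    (hU : U ⊆ Metric.closedBall 0 R) (hl : BddBelow (l '' U)) {u : E} (hu : u ∈ U) {t : ℝ}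
    (ht : 0 < t) : -((H t + conj H U l 0) / t) ≤ l u := by
  have h := le_conj hH hU hl hu ht 0
  rw [inner_zero_right] at h
  rw [← neg_div, div_le_iff₀ ht]
  linarith

/-- Every potential dominates the one rebuilt from its own conjugate; in the limit this gives lower
semicontinuity. -/
lemma le_of_conj {U : Set E} {R : ℝ} {l : E → ℝ} (hH : AssumptionA2 H)
    (hU : U ⊆ Metric.closedBall 0 R) (hl : BddBelow (l '' U)) {u : E} (hu : u ∈ U) {t : ℝ}
    (ht : 0 < t) (v : E) : (inner ℝ u v - H t - conj H U l v) / t ≤ l u := by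
  have h := le_conj hH hU hl hu ht v
  rw [div_le_iff₀ ht]
  linarith

end Potential

/-! ### Pointwise limits of Lipschitz functions -/

/-- The uniform Lipschitz bound reduces Cauchy convergence to a dense sequence of points. With
compactness of a countable product of intervals it plays the role of Arzelà–Ascoli. -/
lemma exists_tendsto_of_tendsto_dense {E : Type*} [NormedAddCommGroup E] {k : ℕ → E → ℝ} {R : ℝ}
    (hk : ∀ n v w, |k n v - k n w| ≤ R * ‖v - w‖) {D : ℕ → E} (hD : DenseRange D)
    (h : ∀ i, ∃ a, Tendsto (fun n => k n (D i)) atTop (𝓝 a)) :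
    ∃ k₀ : E → ℝ, ∀ v, Tendsto (fun n => k n v) atTop (𝓝 (k₀ v)) := by
  suffices ∀ v, ∃ a, Tendsto (fun n => k n v) atTop (𝓝 a) by
    choose k₀ hk₀ using this
    exact ⟨k₀, hk₀⟩
  intro v
  refine cauchySeq_tendsto_of_complete (Metric.cauchySeq_iff.2 fun ε hε => ?_)
  obtain ⟨i, hi⟩ := hD.exists_dist_lt v (show 0 < ε / (4 * (|R| + 1)) by positivity)
  obtain ⟨a, ha⟩ := h i
  obtain ⟨N, hN⟩ := Metric.cauchySeq_iff.1 ha.cauchySeq (ε / 2) (half_pos hε)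
  refine ⟨N, fun m hm n hn => ?_⟩
  have h1 := hN m hm n hn
  have h2 : R * ‖v - D i‖ < ε / 4 := by
    rw [dist_eq_norm, lt_div_iff₀ (by positivity)] at hi
    nlinarith [le_abs_self R, norm_nonneg (v - D i), abs_nonneg R]
  have h3 := hk m v (D i)
  have h4 := hk n v (D i)
  rw [Real.dist_eq] at h1 ⊢
  rw [abs_le] at h3 h4
  rw [abs_lt] at h1 ⊢
  constructor <;> linarith

lemma isCompact_inter_closedBall {E : Type*} [NormedAddCommGroup E] [NormedSpace ℝ E] {S : Set E}
    (hS : IsClosed S) (hfin : FiniteDimensional ℝ (Submodule.span ℝ S)) (r : ℝ) :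
    IsCompact (S ∩ Metric.closedBall 0 r) := by
  have : ProperSpace (Submodule.span ℝ S) := FiniteDimensional.proper ℝ _
  refine ((isCompact_closedBall (0 : Submodule.span ℝ S) r).image
    continuous_subtype_val).of_isClosed_subset (hS.inter Metric.isClosed_closedBall) ?_
  rintro x ⟨hx, hxr⟩
  exact ⟨⟨x, Submodule.subset_span hx⟩, by simpa using hxr, rfl⟩

/-! ### The finite set -/

section FiniteSet

variable {d : ℕ} {Ω : Set (Vec d)} {q : ℝ≥0∞}
  {f : Mat d → ℝ} {S : Set (SobolevAmbient d Ω q)} {φ : SobolevAmbient d Ω q}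

lemma aemeasurable_legendre_comp (f : Mat d → ℝ) (φ : SobolevAmbient d Ω q) :
    AEMeasurable (fun x => legendre f (φ.1 x)) (vol Ω) :=
  (measurable_legendre f).comp_aemeasurable (Lp.aestronglyMeasurable φ.1).aemeasurable

lemma legendre_facts_of_mem_finiteSet [Fact (volume Ω < ⊤)] (hφ : φ ∈ finiteSet f S) :
    (∀ᵐ x ∂vol Ω, legendre f (φ.1 x) = ((legendre f (φ.1 x)).toReal : EReal)) ∧
      Integrable (fun x => (legendre f (φ.1 x)).toReal) (vol Ω) ∧
      extIntegral (vol Ω) (fun x => legendre f (φ.1 x)) =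
        ((∫ x in Ω, (legendre f (φ.1 x)).toReal : ℝ) : EReal) :=
  ae_eq_coe_of_extIntegral_ne_top (aemeasurable_legendre_comp f φ)
    (ae_of_all _ fun _ => neg_le_legendre f _) hφ.2.1

lemma mem_finiteSet_of_ae {h : Vec d → ℝ} (hφ : φ ∈ S)
    (h1 : ∀ᵐ x ∂vol Ω, legendre f (φ.1 x) = (h x : EReal)) (h2 : Integrable h (vol Ω)) :
    φ ∈ finiteSet f S := by
  have := (extIntegral_congr_ae h1).trans (extIntegral_coe h2)
  exact ⟨hφ, by rw [this]; exact EReal.coe_ne_top _, by rw [this]; exact EReal.coe_ne_bot _⟩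

/-- The set of maps of finite energy is convex, and so is `φ ↦ ∫_Ω f^*(φ)` on it. -/
lemma add_smul_sub_mem_finiteSet [Fact (1 ≤ q)] [Fact (volume Ω < ⊤)] (hS : Convex ℝ S) (hφ : φ ∈ finiteSet f S)
    {ψ : SobolevAmbient d Ω q} (hψ : ψ ∈ finiteSet f S) {t : ℝ} (h0 : 0 ≤ t) (h1 : t ≤ 1) :
    φ + t • (ψ - φ) ∈ finiteSet f S ∧
      ∫ x in Ω, (legendre f ((φ + t • (ψ - φ)).1 x)).toReal ≤
        (1 - t) * (∫ x in Ω, (legendre f (φ.1 x)).toReal) +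
          t * ∫ x in Ω, (legendre f (ψ.1 x)).toReal := by
  have hmem : φ + t • (ψ - φ) ∈ S := hS.add_smul_sub_mem hφ.1 hψ.1 ⟨h0, h1⟩
  obtain ⟨a1, a2, -⟩ := legendre_facts_of_mem_finiteSet hφ
  obtain ⟨b1, b2, -⟩ := legendre_facts_of_mem_finiteSet hψ
  have hi : Integrable (fun x => (1 - t) * (legendre f (φ.1 x)).toReal +
      t * (legendre f (ψ.1 x)).toReal) (vol Ω) := (a2.const_mul _).add (b2.const_mul _)
  have hle : ∀ᵐ x ∂vol Ω, legendre f ((φ + t • (ψ - φ)).1 x) ≤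
      (((1 - t) * (legendre f (φ.1 x)).toReal + t * (legendre f (ψ.1 x)).toReal : ℝ) : EReal) := by
    filter_upwards [a1, b1, Lp.coeFn_add φ.1 (t • (ψ.1 - φ.1)), Lp.coeFn_smul t (ψ.1 - φ.1),
      Lp.coeFn_sub ψ.1 φ.1] with x hx1 hx2 k1 k2 k3
    have e : (φ + t • (ψ - φ)).1 x = (1 - t) • φ.1 x + t • ψ.1 x := by
      rw [Prod.fst_add, Prod.smul_fst, Prod.fst_sub, k1, Pi.add_apply, k2, Pi.smul_apply, k3,
        Pi.sub_apply, smul_sub, sub_smul, one_smul]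
      abel
    rw [e]
    exact legendre_convex_comb f (sub_nonneg.2 h1) h0 (by ring) hx1.le hx2.le
  have hfin : ∀ᵐ x ∂vol Ω, legendre f ((φ + t • (ψ - φ)).1 x) =
      ((legendre f ((φ + t • (ψ - φ)).1 x)).toReal : EReal) := by
    filter_upwards [hle] with x hx
    rw [EReal.coe_toReal]
    · exact (hx.trans_lt (EReal.coe_lt_top _)).ne
    · intro h
      have := neg_le_legendre f ((φ + t • (ψ - φ)).1 x)
      rw [h] at this
      simp at this
  have hle' : ∀ᵐ x ∂vol Ω, (legendre f ((φ + t • (ψ - φ)).1 x)).toReal ≤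
      (1 - t) * (legendre f (φ.1 x)).toReal + t * (legendre f (ψ.1 x)).toReal := by
    filter_upwards [hle, hfin] with x h1 h2
    rw [h2] at h1
    exact EReal.coe_le_coe_iff.1 h1
  have hge : ∀ᵐ x ∂vol Ω, -f 0 ≤ (legendre f ((φ + t • (ψ - φ)).1 x)).toReal := by
    filter_upwards [hfin] with x h2
    have := neg_le_legendre f ((φ + t • (ψ - φ)).1 x)
    rw [h2] at this
    exact EReal.coe_le_coe_iff.1 this
  have hint : Integrable (fun x => (legendre f ((φ + t • (ψ - φ)).1 x)).toReal) (vol Ω) :=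
    integrable_of_le_of_le (aemeasurable_legendre_comp f _).ereal_toReal.aestronglyMeasurable
      hge hle' (integrable_const _) hi
  refine ⟨mem_finiteSet_of_ae hmem hfin hint, ?_⟩
  refine (integral_mono_ae hint hi hle').trans_eq ?_
  rw [integral_add (a2.const_mul _) (b2.const_mul _), integral_const_mul, integral_const_mul]

end FiniteSet

/-! ### The dual problem -/

section Dual

variable {d : ℕ} {Ω U : Set (Vec d)} {q : ℝ≥0∞}
  {f : Mat d → ℝ} {H : ℝ → ℝ} {F : Vec d → Vec d} {R : ℝ} {S : Set (SobolevAmbient d Ω q)}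

/-- The potentials admitted in the dual problem. -/
def dualClass (U : Set (Vec d)) : Set (Vec d → ℝ) := {l | IntegrableOn l U ∧ BddBelow (l '' U)}

/-- The energy `∫_Ω f^*(φ)`, when it is finite. -/
def legendreEnergy (f : Mat d → ℝ) (φ : SobolevAmbient d Ω q) : ℝ :=
  ∫ x in Ω, (legendre f (φ.1 x)).toReal

/-- The dual functional. -/
def dualValue (H : ℝ → ℝ) (U : Set (Vec d)) (f : Mat d → ℝ) (F : Vec d → Vec d)
    (l : Vec d → ℝ) (φ : SobolevAmbient d Ω q) : ℝ :=
  (∫ u in U, l u) + (∫ x in Ω, conj H U l (div φ x + F x)) + legendreEnergy f φ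

lemma integrable_comp_of_lipschitz [Fact (volume Ω < ⊤)] {k : Vec d → ℝ}
    (hk : ∀ v w, |k v - k w| ≤ R * ‖v - w‖) {G : Vec d → Vec d} (hG : IntegrableOn G Ω) :
    Integrable (fun x => k (G x)) (vol Ω) := by
  have hc : Continuous k := by
    refine LipschitzWith.continuous (K := R.toNNReal) (LipschitzWith.of_dist_le_mul fun v w => ?_)
    rw [Real.dist_eq, dist_eq_norm]
    refine (hk v w).trans ?_
    gcongr
    exact Real.le_coe_toNNReal R
  refine Integrable.mono' (g := fun x => |k 0| + R * ‖G x‖)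
    ((integrable_const _).add (hG.norm.const_mul R))
    (hc.comp_aestronglyMeasurable hG.aestronglyMeasurable) (ae_of_all _ fun x => ?_)
  have h := hk (G x) 0
  rw [sub_zero] at h
  rw [Real.norm_eq_abs]
  have := abs_sub_abs_le_abs_sub (k (G x)) (k 0)
  linarith

lemma abs_integral_comp_sub_le [Fact (volume Ω < ⊤)] {k : Vec d → ℝ}
    (hk : ∀ v w, |k v - k w| ≤ R * ‖v - w‖) {G G' : Vec d → Vec d} (hG : IntegrableOn G Ω)
    (hG' : IntegrableOn G' Ω) :
    |(∫ x in Ω, k (G x)) - ∫ x in Ω, k (G' x)| ≤ R * ∫ x in Ω, ‖G x - G' x‖ := by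
  rw [← integral_sub (integrable_comp_of_lipschitz hk hG) (integrable_comp_of_lipschitz hk hG'),
    ← integral_const_mul]
  exact abs_integral_le_integral_abs.trans (integral_mono
    ((integrable_comp_of_lipschitz hk hG).sub (integrable_comp_of_lipschitz hk hG')).abs
    ((hG.sub hG').norm.const_mul R) fun x => hk _ _)

variable [Fact (1 ≤ q)] [Fact (volume Ω < ⊤)]

lemma integrable_div_add (hF : IntegrableOn F Ω) (φ : SobolevAmbient d Ω q) :
    IntegrableOn (fun x => div φ x + F x) Ω :=
  (integrable_div φ).add hF

lemma abs_integral_comp_div_sub_le {k : Vec d → ℝ} (hk : ∀ v w, |k v - k w| ≤ R * ‖v - w‖)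
    (hR : 0 ≤ R) (hF : IntegrableOn F Ω) {D : ℝ}
    (hD : ∀ φ : SobolevAmbient d Ω q, ∫ x in Ω, ‖div φ x‖ ≤ D * ‖φ‖) (φ : SobolevAmbient d Ω q) :
    |(∫ x in Ω, k (div φ x + F x)) - volume.real Ω * k 0| ≤
      R * ((∫ x in Ω, ‖F x‖) + D * ‖φ‖) := by
  have h0 : IntegrableOn (fun _ => (0 : Vec d)) Ω := integrable_zero _ _ _
  have e := abs_integral_comp_sub_le hk (integrable_div_add hF φ) h0
  have e1 : ∫ x in Ω, k ((fun _ => (0 : Vec d)) x) = volume.real Ω * k 0 := by simp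
  rw [e1] at e
  refine e.trans ?_
  gcongr
  calc ∫ x in Ω, ‖div φ x + F x - 0‖ ≤ ∫ x in Ω, (‖div φ x‖ + ‖F x‖) := by
        refine integral_mono ?_ ((integrable_div φ).norm.add hF.norm) fun x => ?_
        · simpa using (integrable_div_add hF φ).norm
        · simpa using norm_add_le _ _
    _ = (∫ x in Ω, ‖div φ x‖) + ∫ x in Ω, ‖F x‖ :=
      integral_add (integrable_div φ).norm hF.norm
    _ ≤ _ := by linarith [hD φ]

/-- A two-sided coercivity estimate for the dual functional. -/
lemma exists_dualValue_lower (hH : AssumptionA2 H) (hUo : IsOpen U) (hUn : U.Nonempty)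
    (hU : U ⊆ Metric.closedBall 0 R) (hΩ : IsOpen Ω) (hΩn : Ω.Nonempty)
    (hF : IntegrableOn F Ω) (hf : ∀ A, ∃ C, ∀ x, ‖x‖ ≤ A → f x ≤ C)
    (hS : ∃ C : ℝ, 0 < C ∧ ∀ φ ∈ S, ‖φ‖ ≤ C * ∫ x in Ω, ‖φ.1 x‖) :
    ∃ C m : ℝ, 0 < m ∧ ∀ l ∈ dualClass U, ∀ φ ∈ finiteSet f S,
      m / 2 * conj H U l 0 - C + ‖φ‖ ≤ dualValue H U f F l φ ∧
      -(m * conj H U l 0) - C + ‖φ‖ ≤ dualValue H U f F l φ := by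
  have hR : 0 ≤ R := by
    obtain ⟨u, hu⟩ := hUn
    exact (norm_nonneg u).trans (by simpa using hU hu)
  have hUfin : volume U ≠ ⊤ :=
    ((Metric.isBounded_closedBall.subset hU).measure_lt_top).ne
  have hΩfin : volume Ω ≠ ⊤ := (Fact.out : volume Ω < ⊤).ne
  set m := volume.real Ω with hm
  set μU := volume.real U with hμU
  have hm0 : 0 < m := ENNReal.toReal_pos (hΩ.measure_pos volume hΩn).ne' hΩfin
  have hU0 : 0 < μU := ENNReal.toReal_pos (hUo.measure_pos volume hUn).ne' hUfin
  obtain ⟨C₀, hC₀, hS'⟩ := hS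
  obtain ⟨D, hD, hD'⟩ := exists_integral_norm_div_le Ω q
  -- With this radius f^* has enough slope to absorb the loss R D ‖φ‖ of the transport term and
  -- still leave one full ‖φ‖.
  obtain ⟨B, hB⟩ := hf (C₀ * (1 + R * D))
  have key : ∀ t, 0 < t → ∀ l ∈ dualClass U, ∀ φ ∈ finiteSet f S,
      m * conj H U l 0 - μU * ((H t + conj H U l 0) / t) - (R * ∫ x in Ω, ‖F x‖) - B * m + ‖φ‖ ≤
        dualValue H U f F l φ := by
    intro t ht l hl φ hφ
    have hk := abs_conj_sub_le hH hU hUn hl.2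
    have h1 : -(μU * ((H t + conj H U l 0) / t)) ≤ ∫ u in U, l u := by
      have := setIntegral_mono_on (integrableOn_const hUfin) hl.1 hUo.measurableSet
        fun u hu => conj_zero_lower hH hU hl.2 hu ht
      simpa [hμU, mul_neg] using this
    have h2 : m * conj H U l 0 - R * ((∫ x in Ω, ‖F x‖) + D * ‖φ‖) ≤
        ∫ x in Ω, conj H U l (div φ x + F x) := by
      have e := neg_le_of_abs_le (abs_integral_comp_div_sub_le hk hR hF hD' φ)
      linarith
    have h3 : (1 + R * D) * ‖φ‖ - B * m ≤ legendreEnergy f φ := by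
      obtain ⟨a1, a2, -⟩ := legendre_facts_of_mem_finiteSet hφ
      have i1 : Integrable (fun x => C₀ * (1 + R * D) * ‖φ.1 x‖ - B) (vol Ω) :=
        ((integrable_Lp φ.1).norm.const_mul _).sub (integrable_const _)
      have e1 : ∫ x in Ω, (C₀ * (1 + R * D) * ‖φ.1 x‖ - B) ≤ legendreEnergy f φ := by
        refine integral_mono_ae i1 a2 ?_
        filter_upwards [a1] with x hx
        have := linear_le_legendre f (by positivity) hB (φ.1 x)
        rw [hx] at this
        exact EReal.coe_le_coe_iff.1 this
      rw [integral_sub ((integrable_Lp φ.1).norm.const_mul _) (integrable_const _),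
        integral_const_mul] at e1
      have e2 : ∫ x in Ω, B = B * m := by simp [hm, mul_comm]
      rw [e2] at e1
      have e3 := mul_le_mul_of_nonneg_left (hS' φ hφ.1) (show 0 ≤ 1 + R * D by positivity)
      linarith
    unfold dualValue
    linarith
  -- The coefficient of k(0) in `key` is m - μU/t. The first choice of t makes it m/2, the second
  -- -m, so k(0) is controlled from both sides.
  have ht1 : 0 < 2 * μU / m := by positivity
  have ht2 : 0 < μU / (2 * m) := by positivity
  refine ⟨max (m / 2 * H (2 * μU / m)) (2 * m * H (μU / (2 * m))) + (R * ∫ x in Ω, ‖F x‖) + B * m,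
    m, hm0, fun l hl φ hφ => ⟨?_, ?_⟩⟩
  · have h := key _ ht1 l hl φ hφ
    have e : μU * ((H (2 * μU / m) + conj H U l 0) / (2 * μU / m)) =
        m / 2 * H (2 * μU / m) + m / 2 * conj H U l 0 := by
      field_simp
    rw [e] at h
    linarith [le_max_left (m / 2 * H (2 * μU / m)) (2 * m * H (μU / (2 * m)))]
  · have h := key _ ht2 l hl φ hφ
    have e : μU * ((H (μU / (2 * m)) + conj H U l 0) / (μU / (2 * m))) =
        2 * m * H (μU / (2 * m)) + 2 * m * conj H U l 0 := by
      field_simp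
    rw [e] at h
    linarith [le_max_right (m / 2 * H (2 * μU / m)) (2 * m * H (μU / (2 * m)))]

/-- Limits of the transport part of the dual functional. -/
lemma tendsto_integral_comp {k : ℕ → Vec d → ℝ} {k₀ : Vec d → ℝ}
    (hk : ∀ n v w, |k n v - k n w| ≤ R * ‖v - w‖) (hR : 0 ≤ R)
    (hlim : ∀ v, Tendsto (fun n => k n v) atTop (𝓝 (k₀ v))) (hF : IntegrableOn F Ω)
    {φ : ℕ → SobolevAmbient d Ω q} {φ₀ : SobolevAmbient d Ω q} (hφ : Tendsto φ atTop (𝓝 φ₀)) :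
    Tendsto (fun n => ∫ x in Ω, k n (div (φ n) x + F x)) atTop
      (𝓝 (∫ x in Ω, k₀ (div φ₀ x + F x))) := by
  obtain ⟨D, hD, hD'⟩ := exists_integral_norm_div_le Ω q
  obtain ⟨B, hB⟩ := (hlim 0).abs.bddAbove_range
  have hG := integrable_div_add hF φ₀
  have h1 : Tendsto (fun n => ∫ x in Ω, k n (div φ₀ x + F x)) atTop
      (𝓝 (∫ x in Ω, k₀ (div φ₀ x + F x))) := by
    refine tendsto_integral_of_dominated_convergence (fun x => B + R * ‖div φ₀ x + F x‖)
      (fun n => (integrable_comp_of_lipschitz (hk n) hG).aestronglyMeasurable)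
      ((integrable_const B).add (hG.norm.const_mul R)) (fun n => ae_of_all _ fun x => ?_)
      (ae_of_all _ fun x => hlim _)
    have h := hk n (div φ₀ x + F x) 0
    rw [sub_zero] at h
    have h2 : |k n 0| ≤ B := hB (mem_range_self n)
    rw [Real.norm_eq_abs]
    have := abs_sub_abs_le_abs_sub (k n (div φ₀ x + F x)) (k n 0)
    linarith
  have h2 : Tendsto (fun n => (∫ x in Ω, k n (div (φ n) x + F x)) -
      ∫ x in Ω, k n (div φ₀ x + F x)) atTop (𝓝 0) := by
    have hn : Tendsto (fun n => R * (D * ‖φ n - φ₀‖)) atTop (𝓝 0) := by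
      have := ((tendsto_iff_norm_sub_tendsto_zero.1 hφ).const_mul D).const_mul R
      simpa using this
    refine squeeze_zero_norm (fun n => ?_) hn
    rw [Real.norm_eq_abs]
    refine (abs_integral_comp_sub_le (hk n) (integrable_div_add hF (φ n)) hG).trans ?_
    gcongr
    refine le_trans (le_of_eq ?_) (hD' (φ n - φ₀))
    refine integral_congr_ae ((div_sub (φ n) φ₀).mono fun x hx => ?_)
    simp only [hx, add_sub_add_right_eq_sub]
  simpa using h2.add h1

/-- Lower semicontinuity of `φ ↦ ∫_Ω f^*(φ)`. -/
lemma legendreEnergy_le_of_tendsto {φ : ℕ → SobolevAmbient d Ω q} {φ₀ : SobolevAmbient d Ω q}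
    (hφ : Tendsto φ atTop (𝓝 φ₀)) (hfin : ∀ n, φ n ∈ finiteSet f S) (hφ₀ : φ₀ ∈ S) {e : ℝ}
    (he : Tendsto (fun n => legendreEnergy f (φ n)) atTop (𝓝 e)) :
    φ₀ ∈ finiteSet f S ∧ legendreEnergy f φ₀ ≤ e := by
  have h1 : Tendsto (fun n => (φ n).1) atTop (𝓝 φ₀.1) := (continuous_fst.tendsto _).comp hφ
  -- Convergence in L^q gives almost everywhere convergence along a subsequence; f^* is a supremum
  -- of continuous functions, so Fatou's lemma applies.
  obtain ⟨ns, hns, hae⟩ := (tendstoInMeasure_of_tendsto_Lp h1).exists_seq_tendsto_ae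
  have hfacts := fun n => legendre_facts_of_mem_finiteSet (hfin (ns n))
  have hlow : ∀ n, ∀ᵐ x ∂vol Ω, -f 0 ≤ (legendre f ((φ (ns n)).1 x)).toReal := fun n => by
    filter_upwards [(hfacts n).1] with x hx
    have := neg_le_legendre f ((φ (ns n)).1 x)
    rw [hx] at this
    exact EReal.coe_le_coe_iff.1 this
  obtain ⟨a1, a2, a3⟩ := fatou_ereal (μ := vol Ω) (M := f 0) (aemeasurable_legendre_comp f φ₀)
    (ae_of_all _ fun x => neg_le_legendre f _) (fun n => (hfacts n).2.1) hlow
    (he.comp hns.tendsto_atTop) (by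
      filter_upwards [hae, ae_all_iff.2 fun n => (hfacts n).1] with x hx hx' c hc
      obtain ⟨ξ, hξ⟩ := lt_iSup_iff.1 hc
      have hξ' := EReal.coe_lt_coe_iff.1 hξ
      have hlim : Tendsto (fun n => inner ℝ ξ ((φ (ns n)).1 x) - f ξ) atTop
          (𝓝 (inner ℝ ξ (φ₀.1 x) - f ξ)) := (tendsto_const_nhds.inner hx).sub_const _
      filter_upwards [hlim.eventually_const_lt hξ'] with n hn
      have := le_legendre f ξ ((φ (ns n)).1 x)
      rw [hx' n] at this
      exact hn.le.trans (EReal.coe_le_coe_iff.1 this))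
  exact ⟨mem_finiteSet_of_ae hφ₀ a1 a2, a3⟩

/-- Lower semicontinuity of the potential part of the dual functional. -/
lemma potential_facts_of_tendsto (hH : AssumptionA2 H) (hUo : IsOpen U)
    (hU : U ⊆ Metric.closedBall 0 R) {l : ℕ → Vec d → ℝ} (hl : ∀ n, l n ∈ dualClass U)
    {k₀ : Vec d → ℝ} (hlim : ∀ v, Tendsto (fun n => conj H U (l n) v) atTop (𝓝 (k₀ v))) {a : ℝ}
    (ha : Tendsto (fun n => ∫ u in U, l n u) atTop (𝓝 a)) :
    (∀ u ∈ U, potential H k₀ u ≠ ⊤) ∧ (fun u => (potential H k₀ u).toReal) ∈ dualClass U ∧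
      ∫ u in U, (potential H k₀ u).toReal ≤ a := by
  have : IsFiniteMeasure (vol U) :=
    ⟨by simpa using (Metric.isBounded_closedBall.subset hU).measure_lt_top⟩
  obtain ⟨K, hK⟩ := (hlim 0).bddAbove_range
  have hK' : ∀ n, conj H U (l n) 0 ≤ K := fun n => hK (mem_range_self n)
  have hK0 : k₀ 0 ≤ K := le_of_tendsto' (hlim 0) hK'
  have hlow : ∀ u, ((-(H 1 + K) : ℝ) : EReal) ≤ potential H k₀ u := fun u => by
    refine le_trans (EReal.coe_le_coe_iff.2 ?_) (le_potential H k₀ u 0 one_pos)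
    rw [inner_zero_right, div_one]
    linarith
  obtain ⟨h1, h2, h3⟩ := fatou_ereal (μ := vol U) measurable_potential.aemeasurable
    (ae_of_all _ hlow) (fun n => (hl n).1) (fun n => by
      filter_upwards [ae_restrict_mem hUo.measurableSet] with u hu
      have := conj_zero_lower hH hU (hl n).2 hu one_pos
      rw [div_one] at this
      linarith [hK' n]) ha (by
      filter_upwards [ae_restrict_mem hUo.measurableSet] with u hu c hc
      obtain ⟨w, hw⟩ := lt_iSup_iff.1 hc
      have hw' := EReal.coe_lt_coe_iff.1 hw
      have hlim' : Tendsto (fun n => (inner ℝ u w.1 - H w.2 - conj H U (l n) w.1) / w.2) atTop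
          (𝓝 ((inner ℝ u w.1 - H w.2 - k₀ w.1) / w.2)) :=
        ((hlim w.1).const_sub _).div_const _
      filter_upwards [hlim'.eventually_const_lt hw'] with n hn
      exact hn.le.trans (le_of_conj hH hU (hl n).2 hu w.2.2 _))
  -- Fatou's lemma gives finiteness almost everywhere; convexity upgrades it to every point of `U`.
  have hne : ∀ u ∈ U, potential H k₀ u ≠ ⊤ := fun u hu => by
    refine potential_ne_top hUo ?_ hu
    filter_upwards [h1] with x hx
    rw [hx]
    exact EReal.coe_ne_top _
  refine ⟨hne, ⟨h2, -(H 1 + K), ?_⟩, h3⟩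
  rintro _ ⟨u, hu, rfl⟩
  have := hlow u
  rw [← coe_toReal_potential (hne u hu)] at this
  exact EReal.coe_le_coe_iff.1 this

/-- The dual problem has a solution whose potential is continuous. -/
theorem exists_dual_minimizer (hH : AssumptionA2 H) (hUo : IsOpen U) (hUn : U.Nonempty)
    (hUc : Convex ℝ U) (hU : U ⊆ Metric.closedBall 0 R) (hΩ : IsOpen Ω) (hΩn : Ω.Nonempty)
    (hF : IntegrableOn F Ω) (hf : ∀ A, ∃ C, ∀ x, ‖x‖ ≤ A → f x ≤ C)
    (hS : ∃ C : ℝ, 0 < C ∧ ∀ φ ∈ S, ‖φ‖ ≤ C * ∫ x in Ω, ‖φ.1 x‖) (hSclosed : IsClosed S)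
    (hSfin : FiniteDimensional ℝ (Submodule.span ℝ S)) (hfin : (finiteSet f S).Nonempty) :
    ∃ l ∈ dualClass U, ContinuousOn l U ∧ ∃ φ ∈ finiteSet f S, ∀ l' ∈ dualClass U,
      ∀ φ' ∈ finiteSet f S, dualValue H U f F l φ ≤ dualValue H U f F l' φ' := by
  have hR : 0 ≤ R := by
    obtain ⟨u, hu⟩ := hUn
    exact (norm_nonneg u).trans (by simpa using hU hu)
  have : IsFiniteMeasure (vol U) :=
    ⟨by simpa using (Metric.isBounded_closedBall.subset hU).measure_lt_top⟩
  obtain ⟨C, m, hm, hC⟩ := exists_dualValue_lower (F := F) hH hUo hUn hU hΩ hΩn hF hf hS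
  set V : Set ℝ := {J | ∃ l ∈ dualClass U, ∃ φ ∈ finiteSet f S, dualValue H U f F l φ = J} with hV
  have hVne : V.Nonempty := by
    obtain ⟨φ, hφ⟩ := hfin
    refine ⟨_, fun _ => 0, ⟨integrable_zero _ _ _, 0, ?_⟩, φ, hφ, rfl⟩
    rintro _ ⟨u, -, rfl⟩
    exact le_rfl
  have hVbdd : BddBelow V := by
    refine ⟨-C, ?_⟩
    rintro _ ⟨l, hl, φ, hφ, rfl⟩
    obtain ⟨h1, h2⟩ := hC l hl φ hφ
    linarith [norm_nonneg φ]
  obtain ⟨J, -, hJlim, hJV⟩ := exists_seq_tendsto_sInf hVne hVbdd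
  choose l hl φ hφ hJ using hJV
  obtain ⟨B, hB⟩ := hJlim.bddAbove_range
  have hB' : ∀ n, dualValue H U f F (l n) (φ n) ≤ B := fun n => by
    rw [hJ]; exact hB (mem_range_self n)
  set k := fun n => conj H U (l n) with hk_def
  have hk : ∀ n v w, |k n v - k n w| ≤ R * ‖v - w‖ := fun n => abs_conj_sub_le hH hU hUn (hl n).2
  have hκ : ∃ K : ℝ, ∀ n, |k n 0| ≤ K := by
    refine ⟨max ((B + C) / (m / 2)) ((B + C) / m), fun n => abs_le.2 ⟨?_, ?_⟩⟩
    · obtain ⟨-, h⟩ := hC _ (hl n) _ (hφ n)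
      have : -k n 0 ≤ (B + C) / m := by
        rw [le_div_iff₀ hm]
        linarith [hB' n, norm_nonneg (φ n)]
      linarith [le_max_right ((B + C) / (m / 2)) ((B + C) / m)]
    · obtain ⟨h, -⟩ := hC _ (hl n) _ (hφ n)
      refine le_trans ?_ (le_max_left _ _)
      rw [le_div_iff₀ (by positivity)]
      linarith [hB' n, norm_nonneg (φ n)]
  obtain ⟨K, hK⟩ := hκ
  have hφb : ∃ r, ∀ n, φ n ∈ S ∩ Metric.closedBall 0 r := by
    refine ⟨B + C + m * K, fun n => ⟨(hφ n).1, ?_⟩⟩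
    obtain ⟨-, h⟩ := hC _ (hl n) _ (hφ n)
    rw [mem_closedBall_zero_iff]
    have : m * k n 0 ≤ m * K := by gcongr; exact (le_abs_self _).trans (hK n)
    linarith [hB' n]
  obtain ⟨r, hr⟩ := hφb
  set a := fun n => ∫ u in U, l n u with ha_def
  set b := fun n => ∫ x in Ω, k n (div (φ n) x + F x) with hb_def
  set e := fun n => legendreEnergy f (φ n) with he_def
  have hsum : ∀ n, a n + b n + e n = J n := hJ
  have ha : ∃ A, ∀ n, A ≤ a n := by
    refine ⟨∫ u in U, -(H 1 + K), fun n => setIntegral_mono_on (integrable_const _) (hl n).1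
      hUo.measurableSet fun u hu => ?_⟩
    have h1 := conj_zero_lower hH hU (hl n).2 hu one_pos
    rw [div_one] at h1
    have h2 : conj H U (l n) 0 ≤ K := (le_abs_self _).trans (hK n)
    linarith
  have hb : ∃ A, ∀ n, |b n| ≤ A := by
    obtain ⟨D, hD, hD'⟩ := exists_integral_norm_div_le Ω q
    refine ⟨R * ((∫ x in Ω, ‖F x‖) + D * r) + volume.real Ω * K, fun n => ?_⟩
    have h1 := abs_integral_comp_div_sub_le (hk n) hR hF hD' (φ n)
    have h2 : |volume.real Ω * k n 0| ≤ volume.real Ω * K := by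
      rw [abs_mul, abs_of_nonneg measureReal_nonneg]
      gcongr
      exact hK n
    have h3 : ‖φ n‖ ≤ r := mem_closedBall_zero_iff.1 (hr n).2
    have h4 := abs_sub_abs_le_abs_sub (b n) (volume.real Ω * k n 0)
    have h5 : R * ((∫ x in Ω, ‖F x‖) + D * ‖φ n‖) ≤ R * ((∫ x in Ω, ‖F x‖) + D * r) := by gcongr
    linarith
  have he : ∃ A, ∀ n, A ≤ e n := by
    refine ⟨∫ x in Ω, -f 0, fun n => ?_⟩
    obtain ⟨a1, a2, -⟩ := legendre_facts_of_mem_finiteSet (hφ n)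
    refine integral_mono_ae (integrable_const _) a2 ?_
    filter_upwards [a1] with x hx
    have := neg_le_legendre f ((φ n).1 x)
    rw [hx] at this
    exact EReal.coe_le_coe_iff.1 this
  obtain ⟨A₁, hA₁⟩ := ha
  obtain ⟨A₂, hA₂⟩ := hb
  obtain ⟨A₃, hA₃⟩ := he
  set D := TopologicalSpace.denseSeq (Vec d) with hD_def
  -- One compact set holds the three terms of the functional, the Sobolev map, and the values of the
  -- conjugates on a dense sequence. Each term is bounded below and the sum is bounded above, hence
  -- the upper ends.
  have hcomp : IsCompact ((Icc A₁ (B + A₂ - A₃) ×ˢ (Icc (-A₂) A₂ ×ˢ (Icc A₃ (B + A₂ - A₁) ×ˢ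
      ((S ∩ Metric.closedBall 0 r) ×ˢ
        (univ.pi fun i => Icc (-(K + R * ‖D i‖)) (K + R * ‖D i‖)))))) :
        Set (ℝ × ℝ × ℝ × SobolevAmbient d Ω q × (ℕ → ℝ))) :=
    isCompact_Icc.prod (isCompact_Icc.prod (isCompact_Icc.prod
      ((isCompact_inter_closedBall hSclosed hSfin r).prod
        (isCompact_univ_pi fun i => isCompact_Icc))))
  obtain ⟨z, hz, ns, hns, hlim⟩ := hcomp.tendsto_subseq
    (x := fun n => (a n, b n, e n, φ n, fun i => k n (D i))) fun n => by
      have h1 := hA₁ n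
      have h2 := abs_le.1 (hA₂ n)
      have h3 := hA₃ n
      have h4 := hB' n
      rw [hJ] at h4
      have h5 := hsum n
      refine ⟨⟨h1, by simp only; linarith⟩, h2, ⟨h3, by simp only; linarith⟩, hr n, fun i _ => ?_⟩
      have h6 := hk n (D i) 0
      rw [sub_zero] at h6
      have h7 := abs_sub_abs_le_abs_sub (k n (D i)) (k n 0)
      exact abs_le.1 (by linarith [hK n])
  obtain ⟨a₀, b₀, e₀, φ₀, κ₀⟩ := z
  rw [nhds_prod_eq, nhds_prod_eq, nhds_prod_eq, nhds_prod_eq, tendsto_prod_iff', tendsto_prod_iff',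
    tendsto_prod_iff', tendsto_prod_iff'] at hlim
  obtain ⟨la, lb, le, lφ, lk⟩ := hlim
  rw [tendsto_pi_nhds] at lk
  obtain ⟨k₀, hk₀⟩ := exists_tendsto_of_tendsto_dense (k := fun n => k (ns n))
    (fun n => hk (ns n)) (TopologicalSpace.denseRange_denseSeq (Vec d)) fun i => ⟨_, lk i⟩
  obtain ⟨p1, p2, p3⟩ := potential_facts_of_tendsto hH hUo hU (fun n => hl (ns n)) hk₀ la
  obtain ⟨q1, q2⟩ := legendreEnergy_le_of_tendsto lφ (fun n => hφ (ns n)) hz.2.2.2.1.1 le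
  have hb₀ := tendsto_nhds_unique lb (tendsto_integral_comp (fun n => hk (ns n)) hR hk₀ hF lφ)
  have hk₀l : ∀ v w, |k₀ v - k₀ w| ≤ R * ‖v - w‖ := fun v w =>
    le_of_tendsto' ((hk₀ v).sub (hk₀ w)).abs fun n => hk (ns n) v w
  have hinf : a₀ + b₀ + e₀ = sInf V := by
    refine tendsto_nhds_unique ((la.add lb).add le) ?_
    exact (hJlim.comp hns.tendsto_atTop).congr fun n => (hsum (ns n)).symm
  -- The candidate is the potential of the limit k₀, convex and so continuous on the open set `U`.
  -- Each of its three terms is at most the corresponding limit.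
  refine ⟨_, p2, (convexOn_toReal_potential hUc p1).continuousOn hUo, φ₀, q1,
    fun l' hl' φ' hφ' => ?_⟩
  have hlast : sInf V ≤ dualValue H U f F l' φ' := csInf_le hVbdd ⟨l', hl', φ', hφ', rfl⟩
  have hconj : ∫ x in Ω, conj H U (fun u => (potential H k₀ u).toReal) (div φ₀ x + F x) ≤ b₀ := by
    rw [hb₀]
    exact integral_mono
      (integrable_comp_of_lipschitz (abs_conj_sub_le hH hU hUn p2.2) (integrable_div_add hF φ₀))
      (integrable_comp_of_lipschitz hk₀l (integrable_div_add hF φ₀))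
      fun x => conj_toReal_potential_le hUn p1 _
  unfold dualValue at hlast ⊢
  linarith

end Dual

/-! ### First-order conditions -/

lemma exists_null_sequence :
    ∃ ε : ℕ → ℝ, (∀ n, 0 < ε n) ∧ (∀ n, ε n < 1) ∧ Tendsto ε atTop (𝓝 0) := by
  obtain ⟨ε, -, h, hlim⟩ := exists_seq_strictAnti_tendsto' (show (0 : ℝ) < 1 from one_pos)
  exact ⟨ε, fun n => (h n).1, fun n => (h n).2, hlim⟩

/-! ### Gradients of the conjugate -/

section Gradient

variable {E : Type*} [NormedAddCommGroup E] [InnerProductSpace ℝ E]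
  {H : ℝ → ℝ} {U : Set E} {R : ℝ} {l : E → ℝ}

lemma exists_maximizing_sequence (hH : AssumptionA2 H) (hU : U ⊆ Metric.closedBall 0 R)
    (hUn : U.Nonempty) (hl : BddBelow (l '' U)) (v : E) :
    ∃ u : ℕ → E, ∃ t : ℕ → ℝ, (∀ n, u n ∈ U) ∧ (∀ n, 0 < t n) ∧
      Tendsto (fun n => inner ℝ (u n) v - H (t n) - t n * l (u n)) atTop
        (𝓝 (conj H U l v)) := by
  obtain ⟨ε, hε0, -, hε⟩ := exists_null_sequence
  choose u hu t ht hut using fun n => exists_conj_lt (H := H) hUn l v (hε0 n)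
  refine ⟨u, t, hu, ht, tendsto_of_tendsto_of_tendsto_of_le_of_le ?_ tendsto_const_nhds
    (fun n => (hut n).le) fun n => le_conj hH hU hl (hu n) (ht n) v⟩
  simpa using hε.const_sub (conj H U l v)

variable [CompleteSpace E]

lemma measurable_gradient [MeasurableSpace E] [BorelSpace E] (k : E → ℝ) :
    Measurable (gradient k) :=
  (InnerProductSpace.toDual ℝ E).symm.continuous.measurable.comp (measurable_fderiv ℝ k)

lemma tendsto_gradient_slope {k : E → ℝ} {v : E} (hk : DifferentiableAt ℝ k v) (w : E)
    {ε : ℕ → ℝ} (hε0 : ∀ n, 0 < ε n) (hε : Tendsto ε atTop (𝓝 0)) :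
    Tendsto (fun n => (k (v + ε n • w) - k v) / ε n) atTop (𝓝 (inner ℝ (gradient k v) w)) := by
  have h := (hk.hasGradientAt.hasFDerivAt.hasLineDerivAt w).tendsto_slope_zero
  rw [InnerProductSpace.toDual_apply_apply] at h
  have hε' : Tendsto ε atTop (𝓝[≠] 0) :=
    tendsto_nhdsWithin_iff.2 ⟨hε, Eventually.of_forall fun n => (hε0 n).ne'⟩
  refine (h.comp hε').congr fun n => ?_
  simp only [Function.comp_apply, smul_eq_mul]
  rw [div_eq_inv_mul]

/-- The gradient is a limit of points of `U`. Where k is not differentiable it takes the default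
value 0, which is why 0 must belong to `U`. -/
lemma gradient_conj_mem (hH : AssumptionA2 H) (hU : U ⊆ Metric.closedBall 0 R)
    (hUn : U.Nonempty) (hl : BddBelow (l '' U)) (h0 : (0 : E) ∈ U) (v : E) :
    gradient (conj H U l) v ∈ closure U := by
  by_cases hv : DifferentiableAt ℝ (conj H U l) v
  · obtain ⟨u, t, hu, ht, h⟩ := exists_maximizing_sequence hH hU hUn hl v
    exact mem_closure_of_tendsto (tendsto_of_tendsto_conj hH hU hl hv hu ht h).1
      (Eventually.of_forall hu)
  · rw [gradient_eq_zero_of_not_differentiableAt hv]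
    exact subset_closure h0

/-- If the gradient is an interior point, the supremum in the conjugate is attained there. -/
lemma mul_add_eq_of_gradient_mem (hH : AssumptionA2 H) (hUo : IsOpen U)
    (hU : U ⊆ Metric.closedBall 0 R) (hl : BddBelow (l '' U)) (hlc : ContinuousOn l U) {v : E}
    (hv : DifferentiableAt ℝ (conj H U l) v) (hmem : gradient (conj H U l) v ∈ U) :
    optDensity H (inner ℝ (gradient (conj H U l) v) v - conj H U l v) *
      l (gradient (conj H U l) v) +
      H (optDensity H (inner ℝ (gradient (conj H U l) v) v - conj H U l v)) =
      inner ℝ (gradient (conj H U l) v) v - conj H U l v := by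
  obtain ⟨u, t, hu, ht, h⟩ := exists_maximizing_sequence hH hU ⟨_, hmem⟩ hl v
  obtain ⟨h1, h2, h3⟩ := tendsto_of_tendsto_conj hH hU hl hv hu ht h
  have h4 := (hlc.continuousAt (hUo.mem_nhds hmem)).tendsto.comp h1
  have h5 := (hH.continuousOn.continuousAt (Ioi_mem_nhds (hH.optDensity_pos
    (inner ℝ (gradient (conj H U l) v) v - conj H U l v)))).tendsto.comp h2
  exact tendsto_nhds_unique ((h2.mul h4).add h5) h3

end Gradient

/-- By Rademacher's theorem the bad set of `k` is null, and non-degeneracy makes its preimage under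
`G` null. -/
lemma ae_differentiableAt_comp {d : ℕ} {Ω : Set (Vec d)} {k : Vec d → ℝ} {K : NNReal} (hk : LipschitzWith K k)
    {G : Vec d → Vec d} (hG : NonDegenerate Ω G) (hΩ : MeasurableSet Ω) :
    ∀ᵐ x ∂vol Ω, DifferentiableAt ℝ k (G x) := by
  rw [ae_restrict_iff' hΩ, ae_iff]
  have h := hG {v | ¬DifferentiableAt ℝ k v} (ae_iff.1 hk.ae_differentiableAt)
  convert h using 2
  ext x
  simp

lemma integrable_inner_of_bounded {d : ℕ} {Ω : Set (Vec d)} {u v : Vec d → Vec d} (hu : AEMeasurable u (vol Ω)) {R : ℝ}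
    (hΩ : MeasurableSet Ω) (huR : ∀ x ∈ Ω, ‖u x‖ ≤ R) (hv : Integrable v (vol Ω)) :
    Integrable (fun x => inner ℝ (u x) (v x)) (vol Ω) := by
  refine Integrable.mono' (hv.norm.const_mul R)
    (hu.aestronglyMeasurable.inner hv.aestronglyMeasurable) ?_
  filter_upwards [ae_restrict_mem hΩ] with x hx
  exact (norm_inner_le_norm _ _).trans (by gcongr; exact huR x hx)

/-! ### Variations of the dual functional -/

section FirstOrder

variable {d : ℕ} {Ω U : Set (Vec d)} {q : ℝ≥0∞} [Fact (1 ≤ q)] [Fact (volume Ω < ⊤)]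
  {f : Mat d → ℝ} {H : ℝ → ℝ} {F : Vec d → Vec d} {R : ℝ} {S : Set (SobolevAmbient d Ω q)}
  {l : Vec d → ℝ} {φ : SobolevAmbient d Ω q}

/-- The map `∇k(F + div φ)`, where `k` is the conjugate of `l`. -/
def optMap (H : ℝ → ℝ) (U : Set (Vec d)) (F : Vec d → Vec d) (l : Vec d → ℝ)
    (φ : SobolevAmbient d Ω q) (x : Vec d) : Vec d :=
  gradient (conj H U l) (div φ x + F x)

/-- The density associated with `optMap`. -/
def optWeight (H : ℝ → ℝ) (U : Set (Vec d)) (F : Vec d → Vec d) (l : Vec d → ℝ)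
    (φ : SobolevAmbient d Ω q) (x : Vec d) : ℝ :=
  optDensity H (inner ℝ (optMap H U F l φ x) (div φ x + F x) - conj H U l (div φ x + F x))

lemma aemeasurable_optMap (hF : IntegrableOn F Ω) :
    AEMeasurable (optMap H U F l φ) (vol Ω) :=
  (measurable_gradient _).comp_aemeasurable (integrable_div_add hF φ).aemeasurable

lemma aemeasurable_optWeight (hH : AssumptionA2 H) (hU : U ⊆ Metric.closedBall 0 R)
    (hUn : U.Nonempty) (hl : BddBelow (l '' U)) (hF : IntegrableOn F Ω) :
    AEMeasurable (optWeight H U F l φ) (vol Ω) := by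
  refine hH.measurable_optDensity.comp_aemeasurable (AEMeasurable.sub ?_ ?_)
  · exact (aemeasurable_optMap hF).inner (integrable_div_add hF φ).aemeasurable
  · exact (lipschitzWith_conj hH hU hUn hl).continuous.measurable.comp_aemeasurable
      (integrable_div_add hF φ).aemeasurable

/-- The first-order condition in the Sobolev variable. -/
lemma first_order_sobolev (hH : AssumptionA2 H) (hUn : U.Nonempty)
    (hU : U ⊆ Metric.closedBall 0 R) (hF : IntegrableOn F Ω) (hS : Convex ℝ S)
    (hl : l ∈ dualClass U) (hφ : φ ∈ finiteSet f S)
    (hmin : ∀ φ' ∈ finiteSet f S, dualValue H U f F l φ ≤ dualValue H U f F l φ')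
    (hdiff : ∀ᵐ x ∂vol Ω, DifferentiableAt ℝ (conj H U l) (div φ x + F x))
    {ψ : SobolevAmbient d Ω q} (hψ : ψ ∈ finiteSet f S) :
    0 ≤ legendreEnergy f ψ - legendreEnergy f φ +
      ∫ x in Ω, inner ℝ (optMap H U F l φ x) (div ψ x - div φ x) := by
  obtain ⟨ε, hε0, hε1, hε⟩ := exists_null_sequence
  have hk := abs_conj_sub_le hH hU hUn hl.2
  set k := conj H U l with hk_def
  have hG := integrable_div_add hF φ
  have hw : Integrable (fun x => div ψ x - div φ x) (vol Ω) :=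
    (integrable_div ψ).sub (integrable_div φ)
  have hGn : ∀ n, IntegrableOn (fun x => div φ x + F x + ε n • (div ψ x - div φ x)) Ω := fun n =>
    hG.add (hw.smul (ε n))
  have hlim : Tendsto (fun n => ∫ x in Ω,
      (k (div φ x + F x + ε n • (div ψ x - div φ x)) - k (div φ x + F x)) / ε n) atTop
      (𝓝 (∫ x in Ω, inner ℝ (optMap H U F l φ x) (div ψ x - div φ x))) := by
    refine tendsto_integral_of_dominated_convergence (fun x => R * ‖div ψ x - div φ x‖)
      (fun n => (((integrable_comp_of_lipschitz hk (hGn n)).sub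
        (integrable_comp_of_lipschitz hk hG)).div_const _).aestronglyMeasurable)
      (hw.norm.const_mul R) (fun n => ae_of_all _ fun x => ?_) ?_
    · have := hk (div φ x + F x + ε n • (div ψ x - div φ x)) (div φ x + F x)
      rw [add_sub_cancel_left, norm_smul, Real.norm_of_nonneg (hε0 n).le] at this
      rw [Real.norm_eq_abs, abs_div, abs_of_pos (hε0 n), div_le_iff₀ (hε0 n)]
      linarith
    · filter_upwards [hdiff] with x hx
      exact tendsto_gradient_slope hx _ hε0 hε
  -- Convexity of the Legendre energy along the segment turns minimality into a lower bound for the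
  -- slopes of the transport term, uniform in n.
  have hge : ∀ n, -(legendreEnergy f ψ - legendreEnergy f φ) ≤ ∫ x in Ω,
      (k (div φ x + F x + ε n • (div ψ x - div φ x)) - k (div φ x + F x)) / ε n := fun n => by
    obtain ⟨h1, h2⟩ := add_smul_sub_mem_finiteSet hS hφ hψ (hε0 n).le (hε1 n).le
    have h3 := hmin _ h1
    have e : ∫ x in Ω, k (div (φ + ε n • (ψ - φ)) x + F x) =
        ∫ x in Ω, k (div φ x + F x + ε n • (div ψ x - div φ x)) := by
      refine integral_congr_ae ((div_add_smul_sub (ε n) φ ψ).mono fun x hx => ?_)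
      simp only [hx, add_right_comm]
    unfold dualValue at h3
    rw [← hk_def, e] at h3
    rw [integral_div, integral_sub (integrable_comp_of_lipschitz hk (hGn n))
      (integrable_comp_of_lipschitz hk hG), le_div_iff₀ (hε0 n)]
    unfold legendreEnergy at *
    linarith
  have := ge_of_tendsto' hlim hge
  linarith

lemma add_mul_mem_dualClass {η : Vec d → ℝ} {C : ℝ}
    (hU : U ⊆ Metric.closedBall 0 R) (hl : l ∈ dualClass U) (hη : ∀ u, |η u| ≤ C)
    (hηc : Continuous η) (ε : ℝ) :
    IntegrableOn η U ∧ (fun u => l u + ε * η u) ∈ dualClass U := by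
  have : IsFiniteMeasure (vol U) :=
    ⟨by simpa using (Metric.isBounded_closedBall.subset hU).measure_lt_top⟩
  have hi : IntegrableOn η U := Integrable.of_bound hηc.aestronglyMeasurable C (ae_of_all _ hη)
  exact ⟨hi, hl.1.add (hi.const_mul ε), bddBelow_add_mul hη hl.2 ε⟩

/-- The first-order condition in the potential, as an inequality. -/
lemma first_order_potential_aux (hH : AssumptionA2 H) (hUn : U.Nonempty)
    (hU : U ⊆ Metric.closedBall 0 R) (hF : IntegrableOn F Ω)
    (hl : l ∈ dualClass U)
    (hmin : ∀ l' ∈ dualClass U, dualValue H U f F l φ ≤ dualValue H U f F l' φ)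
    (hdiff : ∀ᵐ x ∂vol Ω, DifferentiableAt ℝ (conj H U l) (div φ x + F x))
    {η : Vec d → ℝ} {C : ℝ} (hη : ∀ u, |η u| ≤ C) (hηc : Continuous η) :
    Integrable (fun x => η (optMap H U F l φ x) * optWeight H U F l φ x) (vol Ω) ∧
      ∫ x in Ω, η (optMap H U F l φ x) * optWeight H U F l φ x ≤ ∫ u in U, η u := by
  obtain ⟨ε, hε0, hε1, hε⟩ := exists_null_sequence
  have hG := integrable_div_add hF φ
  have hη' : ∀ u, |-η u| ≤ C := by simpa using hη
  have hcl : ∀ ε, (fun u => l u + ε * η u) ∈ dualClass U := fun ε =>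
    (add_mul_mem_dualClass hU hl hη hηc ε).2
  have hint : ∀ {l'}, l' ∈ dualClass U →
      Integrable (fun x => conj H U l' (div φ x + F x)) (vol Ω) := fun hl' =>
    integrable_comp_of_lipschitz (abs_conj_sub_le hH hU hUn hl'.2) hG
  have hcl1 : (fun u => l u + η u) ∈ dualClass U := by simpa using hcl 1
  have hcl2 : (fun u => l u + -η u) ∈ dualClass U := by simpa using hcl (-1)
  set b : Vec d → ℝ := fun x => |conj H U (fun u => l u + η u) (div φ x + F x) -
      conj H U l (div φ x + F x)| + |conj H U (fun u => l u + -η u) (div φ x + F x) -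
      conj H U l (div φ x + F x)|
  have hb : Integrable b (vol Ω) :=
    ((hint hcl1).sub (hint hl)).abs.add ((hint hcl2).sub (hint hl)).abs
  -- By convexity in the potential, the slopes lie between those for ε = 1 in the directions -η and
  -- η, which gives an integrable dominating function.
  have hslope : ∀ n x, ‖(conj H U (fun u => l u + ε n * η u) (div φ x + F x) -
      conj H U l (div φ x + F x)) / ε n‖ ≤ b x := fun n x => by
    set v := div φ x + F x
    have h1 := conj_add_mul_le hH hU hUn hl.2 hη v (hε0 n).le (hε1 n).le
    have h2 := conj_add_mul_le hH hU hUn hl.2 hη' v (hε0 n).le (hε1 n).le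
    have h3 := two_mul_conj_le hH hU hUn hl.2 hη v (ε n)
    have p1 := mul_le_mul_of_nonneg_left (le_abs_self (conj H U (fun u => l u + η u) v -
      conj H U l v)) (hε0 n).le
    have p2 := mul_le_mul_of_nonneg_left (le_abs_self (conj H U (fun u => l u + -η u) v -
      conj H U l v)) (hε0 n).le
    have p3 := mul_nonneg (hε0 n).le (abs_nonneg (conj H U (fun u => l u + η u) v -
      conj H U l v))
    have p4 := mul_nonneg (hε0 n).le (abs_nonneg (conj H U (fun u => l u + -η u) v -
      conj H U l v))
    rw [Real.norm_eq_abs, abs_div, abs_of_pos (hε0 n), div_le_iff₀ (hε0 n), abs_le]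
    simp only [b]
    constructor <;> linarith
  have hpt : ∀ᵐ x ∂vol Ω, Tendsto (fun n => (conj H U (fun u => l u + ε n * η u) (div φ x + F x) -
      conj H U l (div φ x + F x)) / ε n) atTop
      (𝓝 (-(η (optMap H U F l φ x) * optWeight H U F l φ x))) := by
    filter_upwards [hdiff] with x hx
    exact tendsto_conj_slope hH hU hUn hl.2 hη hηc hx hε0 hε1 hε
  have hlim := tendsto_integral_of_dominated_convergence b
    (fun n => (((hint (hcl (ε n))).sub (hint hl)).div_const (ε n)).aestronglyMeasurable) hb
    (fun n => ae_of_all _ (hslope n)) hpt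
  refine ⟨?_, ?_⟩
  · refine Integrable.mono' hb ?_ ?_
    · exact ((hηc.measurable.comp_aemeasurable (aemeasurable_optMap hF)).mul
        (aemeasurable_optWeight hH hU hUn hl.2 hF)).aestronglyMeasurable
    · filter_upwards [hpt] with x hx
      have := le_of_tendsto' hx.norm fun n => hslope n x
      rwa [norm_neg] at this
  · have hge : ∀ n, -∫ u in U, η u ≤ ∫ x in Ω,
        (conj H U (fun u => l u + ε n * η u) (div φ x + F x) -
          conj H U l (div φ x + F x)) / ε n := fun n => by
      have h := hmin _ (hcl (ε n))
      have hi := (add_mul_mem_dualClass hU hl hη hηc (ε n)).1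
      unfold dualValue at h
      rw [integral_add hl.1 (hi.const_mul _), integral_const_mul] at h
      rw [integral_div, integral_sub (hint (hcl (ε n))) (hint hl), le_div_iff₀ (hε0 n)]
      linarith
    have := ge_of_tendsto' hlim hge
    rw [integral_neg] at this
    linarith

lemma first_order_potential (hH : AssumptionA2 H) (hUn : U.Nonempty)
    (hU : U ⊆ Metric.closedBall 0 R) (hF : IntegrableOn F Ω)
    (hl : l ∈ dualClass U)
    (hmin : ∀ l' ∈ dualClass U, dualValue H U f F l φ ≤ dualValue H U f F l' φ)
    (hdiff : ∀ᵐ x ∂vol Ω, DifferentiableAt ℝ (conj H U l) (div φ x + F x))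
    {η : Vec d → ℝ} {C : ℝ} (hη : ∀ u, |η u| ≤ C) (hηc : Continuous η) :
    Integrable (fun x => η (optMap H U F l φ x) * optWeight H U F l φ x) (vol Ω) ∧
      ∫ x in Ω, η (optMap H U F l φ x) * optWeight H U F l φ x = ∫ u in U, η u := by
  obtain ⟨h1, h2⟩ := first_order_potential_aux hH hUn hU hF hl hmin hdiff hη hηc
  obtain ⟨-, h3⟩ := first_order_potential_aux (η := fun u => -η u) hH hUn hU hF hl hmin hdiff
    (by simpa using hη) hηc.neg
  refine ⟨h1, le_antisymm h2 ?_⟩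
  simp only [neg_mul, integral_neg] at h3
  linarith

end FirstOrder

/-! ### Admissible pairs -/

section Admissible

variable {d : ℕ} {Ω Λ : Set (Vec d)} {q : ℝ≥0∞} {S : Set (SobolevAmbient d Ω q)} {R : ℝ}
  {w : (Vec d → Vec d) × (Vec d → ℝ)}

lemma norm_le_of_mem_closure (hΛ : Λ ⊆ Metric.closedBall 0 R) {u : Vec d} (hu : u ∈ closure Λ) :
    ‖u‖ ≤ R := by
  simpa using closure_minimal hΛ Metric.isClosed_closedBall hu

lemma integrable_snd_of_admissible (hΩ : MeasurableSet Ω) (hΛ : Λ ⊆ Metric.closedBall 0 R)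
    (hw : w ∈ admissiblePairs Λ S) : Integrable w.2 (vol Ω) := by
  -- A compactly supported test function equal to 1 on a ball containing `closure Λ` recovers the
  -- density itself.
  obtain ⟨η, hη1, -, hηc, -⟩ := exists_continuous_one_zero_of_isCompact
    (isCompact_closedBall (0 : Vec d) R) isClosed_empty (disjoint_empty _)
  refine (hw.2.2.2 η η.continuous hηc).1.congr ?_
  filter_upwards [ae_restrict_mem hΩ] with x hx
  rw [hη1 (mem_closedBall_zero_iff.2 (norm_le_of_mem_closure hΛ (hw.1.2.1 x hx)))]
  simp

/-- The push-forward of the density of an admissible pair is Lebesgue measure on `Λ`. -/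
lemma map_withDensity_eq (hΩ : MeasurableSet Ω) (hΛ : Λ ⊆ Metric.closedBall 0 R)
    (hΛc : Convex ℝ Λ) (hw : w ∈ admissiblePairs Λ S) :
    AEMeasurable w.1 ((vol Ω).withDensity fun x => ((w.2 x).toNNReal : ℝ≥0∞)) ∧
    ((vol Ω).withDensity fun x => ((w.2 x).toNNReal : ℝ≥0∞)).map w.1 = vol (interior Λ) := by
  have hum : AEMeasurable w.1 ((vol Ω).withDensity fun x => ((w.2 x).toNNReal : ℝ≥0∞)) :=
    hw.1.1.mono_ac (withDensity_absolutelyContinuous _ _)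
  refine ⟨hum, ?_⟩
  have hβ := integrable_snd_of_admissible hΩ hΛ hw
  have : IsFiniteMeasure ((vol Ω).withDensity fun x => ((w.2 x).toNNReal : ℝ≥0∞)) :=
    isFiniteMeasure_withDensity_ofReal hβ.2
  have : IsFiniteMeasure (vol (interior Λ)) :=
    ⟨by simpa using (Metric.isBounded_closedBall.subset
      (interior_subset.trans hΛ)).measure_lt_top⟩
  -- Both measures are finite, so compactly supported continuous functions determine them; `Λ` and
  -- its interior differ by a null set because `Λ` is convex.
  refine Measure.ext_of_integral_eq_on_compactlySupported fun η => ?_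
  rw [integral_map (f := fun y => η y) hum η.continuous.aestronglyMeasurable,
    integral_withDensity_eq_integral_smul₀ hβ.aemeasurable.real_toNNReal,
    setIntegral_congr_set (interior_ae_eq_of_null_frontier (hΛc.addHaar_frontier volume)),
    ← (hw.2.2.2 η η.continuous η.hasCompactSupport).2]
  refine setIntegral_congr_fun hΩ fun x hx => ?_
  simp only [NNReal.smul_def, Real.coe_toNNReal _ (hw.2.2.1 x hx), smul_eq_mul, mul_comm]

/-- The push-forward does not charge the boundary. Potentials are controlled only on the interior,
so this is what allows l(u(x)) to be used. -/
lemma ae_mem_interior_of_admissible (hΩ : MeasurableSet Ω) (hΛ : Λ ⊆ Metric.closedBall 0 R)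
    (hΛc : Convex ℝ Λ) (hw : w ∈ admissiblePairs Λ S) :
    ∀ᵐ x ∂vol Ω, 0 < w.2 x → w.1 x ∈ interior Λ := by
  obtain ⟨hum, hmap⟩ := map_withDensity_eq hΩ hΛ hΛc hw
  have h : ∀ᵐ y ∂vol (interior Λ), y ∈ interior Λ := ae_restrict_mem isOpen_interior.measurableSet
  rw [← hmap] at h
  have h' := ae_of_ae_map hum h
  rw [ae_withDensity_iff' (integrable_snd_of_admissible hΩ hΛ
    hw).aemeasurable.real_toNNReal.coe_nnreal_ennreal] at h'
  filter_upwards [h'] with x hx hpos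
  exact hx (by simpa using hpos)

/-- Equality of measures extends the constraint from compactly supported continuous tests to dual
potentials, which are only integrable. -/
lemma integral_comp_mul_of_admissible (hΩ : MeasurableSet Ω) (hΛ : Λ ⊆ Metric.closedBall 0 R)
    (hΛc : Convex ℝ Λ) (hw : w ∈ admissiblePairs Λ S) {l : Vec d → ℝ}
    (hl : IntegrableOn l (interior Λ)) :
    Integrable (fun x => w.2 x * l (w.1 x)) (vol Ω) ∧
      ∫ x in Ω, w.2 x * l (w.1 x) = ∫ u in interior Λ, l u := by
  obtain ⟨hum, hmap⟩ := map_withDensity_eq hΩ hΛ hΛc hw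
  have hβ := (integrable_snd_of_admissible hΩ hΛ hw).aemeasurable.real_toNNReal
  have hl' : Integrable l (vol (interior Λ)) := hl
  rw [← hmap] at hl'
  have e : ∀ x ∈ Ω, (w.2 x).toNNReal • l (w.1 x) = w.2 x * l (w.1 x) := fun x hx => by
    rw [NNReal.smul_def, Real.coe_toNNReal _ (hw.2.2.1 x hx), smul_eq_mul]
  constructor
  · have h1 := (integrable_map_measure hl'.aestronglyMeasurable hum).1 hl'
    rw [integrable_withDensity_iff_integrable_smul₀ hβ] at h1
    exact h1.congr ((ae_restrict_mem hΩ).mono e)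
  · change _ = ∫ u, l u ∂vol (interior Λ)
    rw [← hmap, integral_map hum hl'.aestronglyMeasurable,
      integral_withDensity_eq_integral_smul₀ hβ]
    exact (setIntegral_congr_fun hΩ e).symm

end Admissible

/-! ### The energy -/

section Energy

variable {d : ℕ} {Ω Λ : Set (Vec d)} {q : ℝ≥0∞} {f : Mat d → ℝ} {H : ℝ → ℝ}
  {F : Vec d → Vec d} {S : Set (SobolevAmbient d Ω q)} {R : ℝ}
  {w w' : (Vec d → Vec d) × (Vec d → ℝ)}

lemma energy_congr (h1 : w.1 =ᵐ[vol Ω] w'.1) (h2 : w.2 =ᵐ[vol Ω] w'.2) :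
    energy f H F S w = energy f H F S w' := by
  have e1 : ∀ φ : SobolevAmbient d Ω q,
      ∫ x in Ω, inner ℝ (w.1 x) (div φ x) = ∫ x in Ω, inner ℝ (w'.1 x) (div φ x) := fun φ =>
    integral_congr_ae (h1.mono fun x hx => by simp only [hx])
  have e2 : ∫ x in Ω, inner ℝ (F x) (w.1 x) = ∫ x in Ω, inner ℝ (F x) (w'.1 x) :=
    integral_congr_ae (h1.mono fun x hx => by simp only [hx])
  have e3 : extIntegral (vol Ω) (fun x => extendH H (w.2 x)) =
      extIntegral (vol Ω) (fun x => extendH H (w'.2 x)) :=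
    extIntegral_congr_ae (h2.mono fun x hx => by simp only [hx])
  unfold energy extGradEnergy
  simp only [e1, e2, e3]

lemma extendH_of_pos (H : ℝ → ℝ) {t : ℝ} (ht : 0 < t) : extendH H t = H t := if_pos ht

lemma extendH_of_nonpos (H : ℝ → ℝ) {t : ℝ} (ht : t ≤ 0) : extendH H t = ⊤ := if_neg ht.not_gt

lemma AssumptionA2.measurable_extendH (hH : AssumptionA2 H) : Measurable (extendH H) := by
  classical
  have h : extendH H = (Ioi 0).piecewise (fun t => (H t : EReal)) fun _ => ⊤ := by
    ext1 t
    by_cases ht : 0 < t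
    · rw [extendH_of_pos H ht, piecewise_eq_of_mem _ _ _ (mem_Ioi.2 ht)]
    · rw [extendH_of_nonpos H (not_lt.1 ht), piecewise_eq_of_notMem _ _ _ (by simpa using ht)]
  rw [h]
  exact (continuous_coe_real_ereal.comp_continuousOn hH.continuousOn).measurable_piecewise
    continuousOn_const measurableSet_Ioi

lemma extIntegral_extendH_of_integrable {β : Vec d → ℝ} (hpos : ∀ x, 0 < β x)
    (h : Integrable (fun x => H (β x)) (vol Ω)) :
    extIntegral (vol Ω) (fun x => extendH H (β x)) = ((∫ x in Ω, H (β x) : ℝ) : EReal) := by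
  simp only [extendH_of_pos H (hpos _)]
  exact extIntegral_coe h

variable [Fact (volume Ω < ⊤)]

lemma le_extGradEnergy {φ : SobolevAmbient d Ω q} (hφ : φ ∈ finiteSet f S) (u : Vec d → Vec d) :
    ((-(∫ x in Ω, inner ℝ (u x) (div φ x)) - legendreEnergy f φ : ℝ) : EReal) ≤
      extGradEnergy f S u := by
  refine le_trans (le_of_eq ?_) (le_iSup₂_of_le φ hφ.1 le_rfl)
  rw [(legendre_facts_of_mem_finiteSet hφ).2.2, EReal.coe_sub]
  rfl

/-- Maps with infinite Legendre energy contribute `⊥` to the supremum, so only `finiteSet` matters.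
-/
lemma extGradEnergy_le {u : Vec d → Vec d} {c : ℝ}
    (h : ∀ φ ∈ finiteSet f S, -(∫ x in Ω, inner ℝ (u x) (div φ x)) - legendreEnergy f φ ≤ c) :
    extGradEnergy f S u ≤ c := by
  refine iSup₂_le fun φ hφ => ?_
  by_cases hfin : φ ∈ finiteSet f S
  · rw [(legendre_facts_of_mem_finiteSet hfin).2.2, ← EReal.coe_sub]
    exact EReal.coe_le_coe_iff.2 (h φ hfin)
  · have hbot : extIntegral (vol Ω) (fun x => legendre f (φ.1 x)) ≠ ⊥ :=
      extIntegral_ne_bot (ae_of_all _ fun x => neg_le_legendre f _)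
    have htop : extIntegral (vol Ω) (fun x => legendre f (φ.1 x)) = ⊤ := by
      by_contra hne
      exact hfin ⟨hφ, hne, hbot⟩
    rw [htop, EReal.sub_top]
    exact bot_le

/-- A pair of finite energy has almost everywhere positive density. -/
lemma extIntegral_extendH_facts (hH : AssumptionA2 H) {β : Vec d → ℝ}
    (hβ : AEMeasurable β (vol Ω)) (h : extIntegral (vol Ω) (fun x => extendH H (β x)) ≠ ⊤) :
    (∀ᵐ x ∂vol Ω, 0 < β x) ∧ Integrable (fun x => H (β x)) (vol Ω) ∧
      extIntegral (vol Ω) (fun x => extendH H (β x)) = ((∫ x in Ω, H (β x) : ℝ) : EReal) := by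
  obtain ⟨C, hC⟩ := hH.exists_linear_le 0
  obtain ⟨h1, h2, h3⟩ := ae_eq_coe_of_extIntegral_ne_top (M := C)
    (hH.measurable_extendH.comp_aemeasurable hβ) (ae_of_all _ fun x => by
      rcases lt_or_ge 0 (β x) with hx | hx
      · simp only [Function.comp_apply, extendH_of_pos H hx, EReal.coe_le_coe_iff]
        linarith [hC _ hx]
      · simp only [Function.comp_apply, extendH_of_nonpos H hx, le_top]) h
  have hpos : ∀ᵐ x ∂vol Ω, 0 < β x := by
    filter_upwards [h1] with x hx
    by_contra hcon
    rw [Function.comp_apply, extendH_of_nonpos H (not_lt.1 hcon)] at hx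
    exact EReal.coe_ne_top _ hx.symm
  have e : (fun x => ((extendH H ∘ β) x).toReal) =ᵐ[vol Ω] fun x => H (β x) := by
    filter_upwards [hpos] with x hx
    rw [Function.comp_apply, extendH_of_pos H hx, EReal.toReal_coe]
  exact ⟨hpos, h2.congr e, h3.trans (by rw [integral_congr_ae e])⟩

end Energy

/-! ### From a dual solution to the minimizer -/

/-- A solution of the dual problem at which the conjugate potential is differentiable. -/
structure IsDualSolution {d : ℕ} {Ω : Set (Vec d)} {q : ℝ≥0∞} (U : Set (Vec d)) (f : Mat d → ℝ)
    (H : ℝ → ℝ) (F : Vec d → Vec d) (S : Set (SobolevAmbient d Ω q)) (l : Vec d → ℝ)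
    (φ : SobolevAmbient d Ω q) : Prop where
  mem_class : l ∈ dualClass U
  continuousOn : ContinuousOn l U
  mem_finiteSet : φ ∈ finiteSet f S
  le : ∀ l' ∈ dualClass U, ∀ φ' ∈ finiteSet f S, dualValue H U f F l φ ≤ dualValue H U f F l' φ'
  differentiableAt : ∀ᵐ x ∂vol Ω, DifferentiableAt ℝ (conj H U l) (div φ x + F x)

/-- The pair built from a dual solution. -/
def optPair {d : ℕ} {Ω : Set (Vec d)} {q : ℝ≥0∞} (H : ℝ → ℝ) (U : Set (Vec d))
    (F : Vec d → Vec d) (l : Vec d → ℝ) (φ : SobolevAmbient d Ω q) :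
    (Vec d → Vec d) × (Vec d → ℝ) :=
  (optMap H U F l φ, optWeight H U F l φ)

section DualSolution

variable {d : ℕ} {Ω Λ : Set (Vec d)} {q : ℝ≥0∞} [Fact (1 ≤ q)] [Fact (volume Ω < ⊤)]
  {f : Mat d → ℝ} {H : ℝ → ℝ} {F : Vec d → Vec d} {R : ℝ} {S : Set (SobolevAmbient d Ω q)}
  {l : Vec d → ℝ} {φ : SobolevAmbient d Ω q} {w : (Vec d → Vec d) × (Vec d → ℝ)}

/-- The push-forward constraint is the stationarity of the dual functional in l. The bound on `S`
combines the boundedness of `optMap` with the equivalence of norms, which reduces the W^{1,q} norm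
to the L^q norm. -/
lemma optPair_mem_admissiblePairs (hH : AssumptionA2 H)
    (hΛ : Λ ⊆ Metric.closedBall 0 R) (hΛc : Convex ℝ Λ) (h0 : (0 : Vec d) ∈ interior Λ)
    (hF : IntegrableOn F Ω) (hS : ∃ C : ℝ, 0 < C ∧ ∀ φ ∈ S, ‖φ‖ ≤ C * ∫ x in Ω, ‖φ.1 x‖)
    (hsol : IsDualSolution (interior Λ) f H F S l φ) :
    optPair H (interior Λ) F l φ ∈ admissiblePairs Λ S := by
  have hU : interior Λ ⊆ Metric.closedBall 0 R := interior_subset.trans hΛ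
  have hl := hsol.mem_class
  have hmeas : AEMeasurable (optMap H (interior Λ) F l φ) (vol Ω) := aemeasurable_optMap hF
  have hmem : ∀ x, optMap H (interior Λ) F l φ x ∈ closure Λ := fun x =>
    closure_mono interior_subset (gradient_conj_mem hH hU ⟨0, h0⟩ hl.2 h0 _)
  refine ⟨⟨hmeas, fun x _ => hmem x, ?_⟩, aemeasurable_optWeight hH hU ⟨0, h0⟩ hl.2 hF,
    fun x _ => (hH.optDensity_pos _).le, fun η hη hηc => ?_⟩
  · obtain ⟨C, hC, hC'⟩ := hS
    obtain ⟨D, hD, hD'⟩ := exists_integral_norm_div_le Ω q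
    obtain ⟨B, hB, hB'⟩ := exists_integral_norm_le (Mat d) (vol Ω) q
    have hR : 0 ≤ R := (norm_nonneg _).trans (norm_le_of_mem_closure hΛ (hmem 0))
    refine ⟨R * (D * (C * B)) + 1, by positivity, fun ψ hψ => ?_⟩
    calc |∫ x in Ω, inner ℝ (optMap H (interior Λ) F l φ x) (div ψ x)|
        ≤ ∫ x in Ω, R * ‖div ψ x‖ := by
          rw [← Real.norm_eq_abs]
          refine norm_integral_le_of_norm_le ((integrable_div ψ).norm.const_mul R)
            (ae_of_all _ fun x => (norm_inner_le_norm _ _).trans ?_)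
          gcongr
          exact norm_le_of_mem_closure hΛ (hmem x)
      _ = R * ∫ x in Ω, ‖div ψ x‖ := integral_const_mul _ _
      _ ≤ R * (D * (C * (B * ‖ψ.1‖))) := by
          gcongr
          refine (hD' ψ).trans ?_
          gcongr
          refine (hC' ψ hψ).trans ?_
          gcongr
          exact hB' ψ.1
      _ ≤ (R * (D * (C * B)) + 1) * ‖ψ.1‖ := by linarith [norm_nonneg ψ.1]
  · obtain ⟨C, hC⟩ := hηc.exists_bound_of_continuous hη
    obtain ⟨h1, h2⟩ := first_order_potential hH ⟨0, h0⟩ hU hF hl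
      (fun l' hl' => hsol.le l' hl' φ hsol.mem_finiteSet) hsol.differentiableAt hC hη
    refine ⟨h1, h2.trans ?_⟩
    exact setIntegral_congr_set (interior_ae_eq_of_null_frontier (hΛc.addHaar_frontier volume))

/-- There is no duality gap: the pair attains the supremum defining k, and stationarity in φ says
that φ attains V. -/
lemma energy_optPair_le (hH : AssumptionA2 H) (hΩ : MeasurableSet Ω)
    (hΛ : Λ ⊆ Metric.closedBall 0 R) (hΛc : Convex ℝ Λ) (h0 : (0 : Vec d) ∈ interior Λ)
    (hF : IntegrableOn F Ω) (hS : ∃ C : ℝ, 0 < C ∧ ∀ φ ∈ S, ‖φ‖ ≤ C * ∫ x in Ω, ‖φ.1 x‖)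
    (hSc : Convex ℝ S) (hsol : IsDualSolution (interior Λ) f H F S l φ) :
    energy f H F S (optPair H (interior Λ) F l φ) ≤
      ((-dualValue H (interior Λ) f F l φ : ℝ) : EReal) := by
  have hU : interior Λ ⊆ Metric.closedBall 0 R := interior_subset.trans hΛ
  have hl := hsol.mem_class
  have hadm := optPair_mem_admissiblePairs hH hΛ hΛc h0 hF hS hsol
  set u := optMap H (interior Λ) F l φ with hu
  set β := optWeight H (interior Λ) F l φ with hβ
  set k := conj H (interior Λ) l with hk
  have hpos : ∀ x, 0 < β x := fun x => hH.optDensity_pos _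
  have hR : ∀ x ∈ Ω, ‖u x‖ ≤ R := fun x hx => norm_le_of_mem_closure hΛ (hadm.1.2.1 x hx)
  have hum : AEMeasurable u (vol Ω) := hadm.1.1
  have iF : Integrable (fun x => inner ℝ (u x) (F x)) (vol Ω) :=
    integrable_inner_of_bounded hum hΩ hR hF
  have idiv : ∀ ψ : SobolevAmbient d Ω q, Integrable (fun x => inner ℝ (u x) (div ψ x)) (vol Ω) :=
    fun ψ => integrable_inner_of_bounded hum hΩ hR (integrable_div ψ)
  have ik : Integrable (fun x => k (div φ x + F x)) (vol Ω) :=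
    integrable_comp_of_lipschitz (abs_conj_sub_le hH hU ⟨0, h0⟩ hl.2) (integrable_div_add hF φ)
  obtain ⟨il, hint⟩ := integral_comp_mul_of_admissible hΩ hΛ hΛc hadm hl.1
  change Integrable (fun x => β x * l (u x)) (vol Ω) at il
  change ∫ x in Ω, β x * l (u x) = _ at hint
  -- Equality in the conjugate expresses H(β) through integrable functions; its integrability and
  -- its integral both follow.
  have hHβ : ∀ᵐ x ∂vol Ω, inner ℝ (u x) (div φ x) + inner ℝ (u x) (F x) - k (div φ x + F x) -
      β x * l (u x) = H (β x) := by
    filter_upwards [hsol.differentiableAt, ae_mem_interior_of_admissible hΩ hΛ hΛc hadm]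
      with x hx hx'
    have := mul_add_eq_of_gradient_mem hH isOpen_interior hU hl.2 hsol.continuousOn hx
      (hx' (hpos x))
    rw [← inner_add_right]
    exact sub_eq_of_eq_add' this.symm
  have i1 : Integrable (fun x => inner ℝ (u x) (div φ x) + inner ℝ (u x) (F x)) (vol Ω) :=
    (idiv φ).add iF
  have i2 : Integrable (fun x => inner ℝ (u x) (div φ x) + inner ℝ (u x) (F x) -
      k (div φ x + F x)) (vol Ω) := i1.sub ik
  have iH : Integrable (fun x => H (β x)) (vol Ω) := (i2.sub il).congr hHβ
  have eH : ∫ x in Ω, H (β x) = (∫ x in Ω, inner ℝ (u x) (div φ x)) +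
      (∫ x in Ω, inner ℝ (u x) (F x)) - (∫ x in Ω, k (div φ x + F x)) -
      ∫ u in interior Λ, l u := by
    rw [← hint, ← integral_congr_ae hHβ, integral_sub i2 il, integral_sub i1 ik,
      integral_add (idiv φ) iF]
  have hV : extGradEnergy f S u ≤
      ((-(∫ x in Ω, inner ℝ (u x) (div φ x)) - legendreEnergy f φ : ℝ) : EReal) := by
    refine extGradEnergy_le fun ψ hψ => ?_
    have h1 := first_order_sobolev hH ⟨0, h0⟩ hU hF hSc hl hsol.mem_finiteSet
      (fun φ' hφ' => hsol.le l hl φ' hφ') hsol.differentiableAt hψ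
    have h2 : ∫ x in Ω, inner ℝ (u x) (div ψ x - div φ x) =
        (∫ x in Ω, inner ℝ (u x) (div ψ x)) - ∫ x in Ω, inner ℝ (u x) (div φ x) := by
      rw [← integral_sub (idiv ψ) (idiv φ)]
      simp only [inner_sub_right]
    rw [← hu, h2] at h1
    linarith
  have eF : ∫ x in Ω, inner ℝ (F x) (u x) = ∫ x in Ω, inner ℝ (u x) (F x) := by
    simp only [real_inner_comm]
  unfold energy
  change extGradEnergy f S u + extIntegral (vol Ω) (fun x => extendH H (β x)) -
    ((∫ x in Ω, inner ℝ (F x) (u x) : ℝ) : EReal) ≤ _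
  rw [extIntegral_extendH_of_integrable hpos iH, eF]
  calc _ ≤ ((-(∫ x in Ω, inner ℝ (u x) (div φ x)) - legendreEnergy f φ : ℝ) : EReal) +
        ((∫ x in Ω, H (β x) : ℝ) : EReal) - ((∫ x in Ω, inner ℝ (u x) (F x) : ℝ) : EReal) :=
        EReal.sub_le_sub (by gcongr) le_rfl
    _ = _ := by
        rw [← EReal.coe_add, ← EReal.coe_sub, eH]
        unfold dualValue
        congr 1
        ring

/-- The duality gap is the integral of a non-negative function `g`. The energy bound forces ∫ g ≤ 0,
hence g = 0 and (u(x), β(x)) attains the supremum defining k almost everywhere. -/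
lemma eq_optPair_of_energy_le (hH : AssumptionA2 H) (hΩ : MeasurableSet Ω)
    (hΛ : Λ ⊆ Metric.closedBall 0 R) (hΛc : Convex ℝ Λ) (h0 : (0 : Vec d) ∈ interior Λ)
    (hF : IntegrableOn F Ω) (hsol : IsDualSolution (interior Λ) f H F S l φ)
    (hw : w ∈ admissiblePairs Λ S)
    (hle : energy f H F S w ≤ ((-dualValue H (interior Λ) f F l φ : ℝ) : EReal)) :
    w.1 =ᵐ[vol Ω] (optPair H (interior Λ) F l φ).1 ∧
      w.2 =ᵐ[vol Ω] (optPair H (interior Λ) F l φ).2 := by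
  have hU : interior Λ ⊆ Metric.closedBall 0 R := interior_subset.trans hΛ
  have hl := hsol.mem_class
  obtain ⟨u, β⟩ := w
  set k := conj H (interior Λ) l with hk
  have hR : ∀ x ∈ Ω, ‖u x‖ ≤ R := fun x hx => norm_le_of_mem_closure hΛ (hw.1.2.1 x hx)
  have hum : AEMeasurable u (vol Ω) := hw.1.1
  have iF : Integrable (fun x => inner ℝ (u x) (F x)) (vol Ω) :=
    integrable_inner_of_bounded hum hΩ hR hF
  have idiv : Integrable (fun x => inner ℝ (u x) (div φ x)) (vol Ω) :=
    integrable_inner_of_bounded hum hΩ hR (integrable_div φ)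
  have ik : Integrable (fun x => k (div φ x + F x)) (vol Ω) :=
    integrable_comp_of_lipschitz (abs_conj_sub_le hH hU ⟨0, h0⟩ hl.2) (integrable_div_add hF φ)
  obtain ⟨il, hint⟩ := integral_comp_mul_of_admissible hΩ hΛ hΛc hw hl.1
  simp only at il hint
  have eF : ∫ x in Ω, inner ℝ (F x) (u x) = ∫ x in Ω, inner ℝ (u x) (F x) := by
    simp only [real_inner_comm]
  have hV := le_extGradEnergy hsol.mem_finiteSet u
  unfold energy at hle
  simp only [eF] at hle
  have hfin : extIntegral (vol Ω) (fun x => extendH H (β x)) ≠ ⊤ := by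
    intro htop
    rw [htop, EReal.add_top_of_ne_bot, EReal.top_sub_coe] at hle
    · exact EReal.coe_ne_top _ (top_le_iff.1 hle)
    · exact ne_bot_of_le_ne_bot (EReal.coe_ne_bot _) hV
  obtain ⟨hpos, iH, eH⟩ := extIntegral_extendH_facts hH hw.2.1 hfin
  rw [eH] at hle
  have hle' : ((-(∫ x in Ω, inner ℝ (u x) (div φ x)) - legendreEnergy f φ : ℝ) : EReal) +
        ((∫ x in Ω, H (β x) : ℝ) : EReal) - ((∫ x in Ω, inner ℝ (u x) (F x) : ℝ) : EReal) ≤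
        ((-dualValue H (interior Λ) f F l φ : ℝ) : EReal) :=
    le_trans (EReal.sub_le_sub (by gcongr) le_rfl) hle
  rw [← EReal.coe_add, ← EReal.coe_sub, EReal.coe_le_coe_iff] at hle'
  unfold dualValue at hle'
  set g : Vec d → ℝ := fun x => H (β x) + β x * l (u x) -
    (inner ℝ (u x) (div φ x) + inner ℝ (u x) (F x)) + k (div φ x + F x) with hg
  simp only at iH
  have i1 : Integrable (fun x => inner ℝ (u x) (div φ x) + inner ℝ (u x) (F x)) (vol Ω) :=
    idiv.add iF
  have i2 : Integrable (fun x => H (β x) + β x * l (u x)) (vol Ω) := iH.add il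
  have i3 : Integrable (fun x => H (β x) + β x * l (u x) -
    (inner ℝ (u x) (div φ x) + inner ℝ (u x) (F x))) (vol Ω) := i2.sub i1
  have ig : Integrable g (vol Ω) := i3.add ik
  have eg : ∫ x in Ω, g x ≤ 0 := by
    rw [hg, integral_add i3 ik, integral_sub i2 i1, integral_add iH il, integral_add idiv iF, hint]
    linarith
  have hU' := ae_mem_interior_of_admissible hΩ hΛ hΛc hw
  have hg0 : ∀ᵐ x ∂vol Ω, 0 ≤ g x := by
    filter_upwards [hpos, hU'] with x hx hx'
    have := le_conj hH hU hl.2 (hx' hx) hx (div φ x + F x)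
    rw [inner_add_right] at this
    simp only [hg]
    linarith
  have hgz := (integral_eq_zero_iff_of_nonneg_ae hg0 ig).1
    (le_antisymm eg (integral_nonneg_of_ae hg0))
  have key : ∀ᵐ x ∂vol Ω, u x = optMap H (interior Λ) F l φ x ∧
      β x = optWeight H (interior Λ) F l φ x := by
    filter_upwards [hgz, hpos, hU', hsol.differentiableAt] with x h1 h2 h3 h4
    have hval : inner ℝ (u x) (div φ x + F x) - H (β x) - β x * l (u x) =
        k (div φ x + F x) := by
      simp only [hg, Pi.zero_apply] at h1
      rw [inner_add_right]
      linarith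
    -- A maximizer is a constant maximizing sequence, so it equals the limit.
    obtain ⟨c1, c2, -⟩ := tendsto_of_tendsto_conj hH hU hl.2 h4 (u := fun _ => u x)
      (t := fun _ => β x) (fun _ => h3 h2) (fun _ => h2) (by
        simp only [hval]
        exact tendsto_const_nhds)
    exact ⟨tendsto_nhds_unique tendsto_const_nhds c1, tendsto_nhds_unique tendsto_const_nhds c2⟩
  exact ⟨key.mono fun x hx => hx.1, key.mono fun x hx => hx.2⟩

/-- A dual solution yields the unique minimizer of the energy. -/
theorem exists_unique_minimizer_of_dual (hH : AssumptionA2 H) (hΩ : MeasurableSet Ω)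
    (hΛ : Λ ⊆ Metric.closedBall 0 R) (hΛc : Convex ℝ Λ) (h0 : (0 : Vec d) ∈ interior Λ)
    (hF : IntegrableOn F Ω) (hS : ∃ C : ℝ, 0 < C ∧ ∀ φ ∈ S, ‖φ‖ ≤ C * ∫ x in Ω, ‖φ.1 x‖)
    (hSc : Convex ℝ S) (hsol : IsDualSolution (interior Λ) f H F S l φ) :
    ∃ w, IsMinimizer Λ f H F S w ∧ ∀ w', IsMinimizer Λ f H F S w' →
      w'.1 =ᵐ[vol Ω] w.1 ∧ w'.2 =ᵐ[vol Ω] w.2 := by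
  have hadm := optPair_mem_admissiblePairs hH hΛ hΛc h0 hF hS hsol
  have hle := energy_optPair_le hH hΩ hΛ hΛc h0 hF hS hSc hsol
  refine ⟨optPair H (interior Λ) F l φ, ⟨hadm, fun w hw => ?_⟩, fun w hw =>
    eq_optPair_of_energy_le hH hΩ hΛ hΛc h0 hF hsol hw.1 ((hw.2 hadm).trans hle)⟩
  change energy f H F S _ ≤ energy f H F S w
  by_contra hcon
  have hlt := not_le.1 hcon
  -- A pair of smaller energy would coincide with `optPair` almost everywhere, and hence have the
  -- same energy.
  obtain ⟨h1, h2⟩ := eq_optPair_of_energy_le hH hΩ hΛ hΛc h0 hF hsol hw (hlt.le.trans hle)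
  exact hlt.ne (energy_congr h1 h2)

end DualSolution

/-! ### Maps of countable range -/

/-- In positive dimension the countable range is itself a null set, and its preimage is all of `Ω`.
-/
lemma not_nonDegenerate_of_countable {d : ℕ} (hd : 0 < d) {Ω : Set (Vec d)} (hΩ : IsOpen Ω)
    (hΩn : Ω.Nonempty) {F : Vec d → Vec d} (hF : (F '' Ω).Countable) : ¬NonDegenerate Ω F := by
  intro h
  have : Nonempty (Fin d) := ⟨⟨0, hd⟩⟩
  have h0 := h (F '' Ω) (hF.measure_zero volume)
  rw [inter_eq_left.2 (subset_preimage_image F Ω)] at h0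
  exact (hΩ.measure_pos volume hΩn).ne' h0

/-- On each level set F = c the sum is a translate of `G`, and translates of null sets are null. -/
lemma NonDegenerate.add_countable {d : ℕ} {Ω : Set (Vec d)} {G F : Vec d → Vec d}
    (hG : NonDegenerate Ω G) (hF : (F '' Ω).Countable) : NonDegenerate Ω fun x => G x + F x := by
  intro N hN
  refine measure_mono_null (t := ⋃ c ∈ F '' Ω, Ω ∩ G ⁻¹' ((fun y => y + c) ⁻¹' N)) ?_ ?_
  · rintro x ⟨hx, hxN⟩
    exact mem_biUnion (mem_image_of_mem F hx) ⟨hx, hxN⟩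
  · exact (measure_biUnion_null_iff hF).2 fun c _ => hG _ (by rw [measure_preimage_add_right, hN])

end Polyconvex

end

/-! ### The main theorem -/

open Polyconvex in
theorem corollary3p6 (d : ℕ) (hd : 0 < d)
    (Ω Λ : Set (Polyconvex.Vec d))
    (hΩo : IsOpen Ω) (hΩn : Ω.Nonempty) (hΩb : Bornology.IsBounded Ω) (hΩc : Convex ℝ Ω)
    (hΛc : Convex ℝ Λ) (r : ℝ) (hr : 1 < r)
    (hΛin : Metric.ball 0 (1 / r) ⊆ Λ) (hΛout : Λ ⊆ Metric.ball 0 (r / 2))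
    (p q : ℝ) (hp : 1 < p) (hpq : p.HolderConjugate q) [Fact (1 ≤ ENNReal.ofReal q)]
    (f : Polyconvex.Mat d → ℝ) (H : ℝ → ℝ) (F : Polyconvex.Vec d → Polyconvex.Vec d)
    (S : Set (Polyconvex.SobolevAmbient d Ω (ENNReal.ofReal q)))
    (hSsub : S ⊆ Polyconvex.sobolevZero Ω (ENNReal.ofReal q))
    (hSfin : FiniteDimensional ℝ (Submodule.span ℝ S))
    (hSne : S.Nonempty) (hSclosed : IsClosed S) (hSconv : Convex ℝ S)
    (hSdiv : ∀ φ ∈ S, Polyconvex.NonDegenerate Ω (Polyconvex.div φ))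
    (hA0 : Polyconvex.AssumptionA0 Ω)
    (hA1 : Polyconvex.AssumptionA1 p q f S)
    (hA2 : Polyconvex.AssumptionA2 H)
    (hA3 : IntegrableOn F Ω)
    (hFrange : (F '' Ω).Countable) :
    ¬ Polyconvex.NonDegenerate Ω F ∧
    Polyconvex.ConditionND F S ∧
    ∃ w, Polyconvex.IsMinimizer Λ f H F S w ∧
      ∀ w', Polyconvex.IsMinimizer Λ f H F S w' →
        w'.1 =ᵐ[volume.restrict Ω] w.1 ∧ w'.2 =ᵐ[volume.restrict Ω] w.2 := by
  have hND : ConditionND F S := fun φ hφ => (hSdiv φ hφ).add_countable hFrange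
  refine ⟨not_nonDegenerate_of_countable hd hΩo hΩn hFrange, hND, ?_⟩
  have hfact : Fact (volume Ω < ⊤) := ⟨hΩb.measure_lt_top⟩
  have hΛ : Λ ⊆ Metric.closedBall 0 (r / 2) := hΛout.trans Metric.ball_subset_closedBall
  have h0 : (0 : Vec d) ∈ interior Λ :=
    mem_interior.2 ⟨_, hΛin, Metric.isOpen_ball, Metric.mem_ball_self (by positivity)⟩
  have hU : interior Λ ⊆ Metric.closedBall 0 (r / 2) := interior_subset.trans hΛ
  -- The upper growth bound makes f bounded above on balls, which gives f^* arbitrarily large linear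
  -- slope.
  have hf : ∀ A, ∃ C, ∀ x, ‖x‖ ≤ A → f x ≤ C := by
    obtain ⟨a, b, c, -, -, hc, hgrowth, -⟩ := hA1.growth
    intro A
    refine ⟨c * (A ^ p / p) + b, fun x hx => (hgrowth x).1.trans ?_⟩
    gcongr
  have hS := exists_norm_le_integral_norm hΩo hSsub hSfin
  obtain ⟨l, hl, hlc, φ, hφ, hmin⟩ := exists_dual_minimizer hA2 isOpen_interior ⟨0, h0⟩
    hΛc.interior hU hΩo hΩn hA3 hf hS hSclosed hSfin hA1.finite_nonempty
  exact exists_unique_minimizer_of_dual hA2 hΩo.measurableSet hΛ hΛc h0 hA3 hS hSconv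
    ⟨hl, hlc, hφ, hmin, ae_differentiableAt_comp
      (lipschitzWith_conj hA2 hU ⟨0, h0⟩ hl.2) (hND φ hφ.1) hΩo.measurableSet⟩
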